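/- All graphs are finite and simple. A weighted graph is a graph $G$ with a weighting $w:E(G)\to(0,\infty]$; $\mathrm{dist}_G(u,v)$ is the least total weight of a path from $u$ to $v$ ($\infty$ if there is none). A class of weighted graphs is a collection closed under (weight-preserving) isomorphism. For $r>0$, let $G^r$ be the graph on $V(G)$ in which distinct $u,v$ are adjacent if $\mathrm{dist}_G(u,v)\le r$. For an integer $m\ge 1$ and $d\ge 0$, an $(m,r,d)$-colouring of $G$ is a map $c:V(G)\to\{1,\dots,m\}$ such that, for every colour $i$ and every maximal nonempty connected subgraph $M$ of $G^r$ all of whose vertices have colour $i$, any two vertices of $M$ are at distance at most $d$ in $G$. For an integer $n\ge 0$, a function $f:(0,\infty)\to(0,\infty)$ is an $n$-dimensional control function for a class $\mathcal G$ of weighted graphs if every $G\in\mathcal G$ has an $(n+1,r,f(r))$-colouring for every real $r>0$. It is a dilation if there is a real $c>0$ with $f(r)\le cr$ for all $r>0$. The Assouad--Nagata dimension $\mathrm{ANdim}(\mathcal G)$ is the smallest integer $n\ge 0$ such that some dilation is an $n$-dimensional control function for $\mathcal G$, or $\infty$ if there is none. A tree-decomposition of $G$ is a family $(B_t:t\in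 V(T))$ of subsets of $V(G)$ indexed by the vertices of a (finite) tree $T$ such that for each $v\in V(G)$ the set $\{t: v\in B_t\}$ induces a nonempty connected subgraph of $T$, and each edge of $G$ has both ends in some $B_t$. Its adhesion is $\max_{tt'\in E(T)}|B_t\cap B_{t'}|$ (and $0$ if $T$ has no edge). The weighted torso at $t$ is the weighted graph with vertex set $B_t$ in which distinct $u,v$ are adjacent if $uv\in E(G)$ or $u,v\in B_t\cap B_{t'}$ for some neighbour $t'$ of $t$ in $T$, each edge $uv$ having weight $\mathrm{dist}_G(u,v)$ (the distance in the whole graph $G$). Theorem. Let $k\ge 0$ be an integer, let $\mathcal H$ be a class of weighted graphs, and let $\mathcal G$ be a class of weighted graphs such that every $G\in\mathcal G$ has a tree-decomposition of adhesion at most $k$ all of whose weighted torsos are in $\mathcal H$. Then $$\mathrm{ANdim}(\mathcal G)\le\max(\mathrm{ANdim}(\mathcal H),1).$$ -/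

import Mathlib

open scoped ENNReal

universe u v

/-- A finite weighted graph: a finite simple graph with edge weights in `(0, ∞]`.
The weight of the edge `uv` is given as a symmetric function of the adjacent pair `(u, v)`. -/
structure WeightedGraph where
  /-- the vertex set -/
  V : Type u
  finite : Finite V
  /-- the underlying unweighted graph -/
  graph : SimpleGraph V
  /-- the weighting -/
  weight : ∀ {x y : V}, graph.Adj x y → ℝ≥0∞
  weight_symm : ∀ {x y : V} (h : graph.Adj x y), weight h.symm = weight h
  weight_pos : ∀ {x y : V} (h : graph.Adj x y), 0 < weight h

namespace WeightedGraph

instance (G : WeightedGraph.{u}) : Finite G.V := G.finite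

/-- Two weighted graphs are isomorphic if there is an isomorphism of the underlying graphs that
preserves the weights of edges. -/
def Isomorphic (G H : WeightedGraph.{u}) : Prop :=
  ∃ φ : G.graph ≃g H.graph, ∀ (x y : G.V) (h : G.graph.Adj x y),
    H.weight (φ.map_rel_iff.2 h) = G.weight h

/-- A class of weighted graphs: a collection closed under isomorphism. -/
def IsGraphClass (𝓒 : Set WeightedGraph.{u}) : Prop :=
  ∀ G H : WeightedGraph.{u}, G ∈ 𝓒 → Isomorphic G H → H ∈ 𝓒

/-- The length of a walk: the sum of the weights of its edges (with multiplicity). -/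
noncomputable def walkLength (G : WeightedGraph.{u}) :
    {x y : G.V} → G.graph.Walk x y → ℝ≥0∞
  | _, _, .nil => 0
  | _, _, .cons h p => G.weight h + G.walkLength p

/-- The distance between two vertices: the length of a shortest path, and `∞` if there is no path
(there are finitely many paths, so the infimum over a nonempty set of paths is a minimum). -/
noncomputable def dist (G : WeightedGraph.{u}) (x y : G.V) : ℝ≥0∞ :=
  ⨅ p : G.graph.Path x y, G.walkLength p.1

theorem walkLength_append (G : WeightedGraph.{u}) {x y z : G.V} (p : G.graph.Walk x y)
    (q : G.graph.Walk y z) : G.walkLength (p.append q) = G.walkLength p + G.walkLength q := by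
  induction p with
  | nil => simp [walkLength]
  | cons h p ih => simp [walkLength, ih, add_assoc]

theorem walkLength_reverse (G : WeightedGraph.{u}) {x y : G.V} (p : G.graph.Walk x y) :
    G.walkLength p.reverse = G.walkLength p := by
  induction p with
  | nil => simp [walkLength]
  | cons h p ih =>
    simp [walkLength, walkLength_append, ih, G.weight_symm h, add_comm]

theorem dist_comm (G : WeightedGraph.{u}) (x y : G.V) : G.dist x y = G.dist y x := by
  have key : ∀ x y : G.V, G.dist x y ≤ G.dist y x := fun x y =>
    le_iInf fun p => (iInf_le _ p.reverse).trans (G.walkLength_reverse p.1).le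
  exact le_antisymm (key x y) (key y x)

theorem dist_pos (G : WeightedGraph.{u}) {x y : G.V} (hxy : x ≠ y) : 0 < G.dist x y := by
  have hw : ∀ p : G.graph.Path x y, 0 < G.walkLength p.1 := by
    rintro ⟨p, -⟩
    cases p with
    | nil => exact absurd rfl hxy
    | cons h p => exact lt_of_lt_of_le (G.weight_pos h) le_self_add
  classical
  have := Fintype.ofFinite G.V
  have : Finite (G.graph.Path x y) := Finite.of_fintype _
  rcases isEmpty_or_nonempty (G.graph.Path x y) with h | h
  · rw [dist, iInf_of_empty]
    exact ENNReal.zero_lt_top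
  · obtain ⟨p, hp⟩ := Finite.exists_min fun p : G.graph.Path x y => G.walkLength p.1
    exact (hw p).trans_le (le_iInf hp)

/-- The weak diameter in `G` of a set of vertices: the largest distance in `G` between two of its
elements. -/
noncomputable def weakDiam (G : WeightedGraph.{u}) (S : Set G.V) : ℝ≥0∞ :=
  ⨆ x ∈ S, ⨆ y ∈ S, G.dist x y

/-- The `r`-th power of `G`: distinct vertices are adjacent if their distance is at most `r`. -/
def power (G : WeightedGraph.{u}) (r : ℝ) : SimpleGraph G.V where
  Adj x y := x ≠ y ∧ G.dist x y ≤ ENNReal.ofReal r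
  symm := ⟨fun x y h => ⟨h.1.symm, G.dist_comm x y ▸ h.2⟩⟩
  loopless := ⟨fun _ h => h.1 rfl⟩

/-- `M` is a monochromatic `r`-component of `G` under the colouring `c`: for some colour `i`,
it is a maximal nonempty connected subgraph of the `r`-th power all of whose vertices have
colour `i` (`Subgraph.Connected` includes nonemptiness). -/
def IsMonochromaticComponent (G : WeightedGraph.{u}) {m : ℕ} (c : G.V → Fin m) (r : ℝ)
    (M : (G.power r).Subgraph) : Prop :=
  ∃ i : Fin m,
    Maximal (fun N : (G.power r).Subgraph => N.Connected ∧ ∀ x ∈ N.verts, c x = i) M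

/-- `c` is an `(m, r, d)`-colouring of `G`: every monochromatic `r`-component has weak diameter
at most `d` in `G`. -/
def IsColouring (G : WeightedGraph.{u}) (m : ℕ) (r d : ℝ) (c : G.V → Fin m) : Prop :=
  ∀ M : (G.power r).Subgraph, G.IsMonochromaticComponent c r M →
    G.weakDiam M.verts ≤ ENNReal.ofReal d

/-- `f : ℝ⁺ → ℝ⁺` is an `n`-dimensional control function for the weighted graph `G`. -/
def IsControlFunction (n : ℕ) (f : Set.Ioi (0 : ℝ) → Set.Ioi (0 : ℝ))
    (G : WeightedGraph.{u}) : Prop :=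
  ∀ r : Set.Ioi (0 : ℝ), ∃ c : G.V → Fin (n + 1), G.IsColouring (n + 1) r (f r) c

/-- `f` is a dilation: it is bounded by a linear function. -/
def IsDilation (f : Set.Ioi (0 : ℝ) → Set.Ioi (0 : ℝ)) : Prop :=
  ∃ c : ℝ, 0 < c ∧ ∀ r : Set.Ioi (0 : ℝ), (f r : ℝ) ≤ c * (r : ℝ)

/-- The Assouad–Nagata dimension of a class of weighted graphs: the least `n` such that some
dilation is an `n`-dimensional control function for every member of the class, and `∞` if there
is no such `n`. -/
noncomputable def ANdim (𝓒 : Set WeightedGraph.{u}) : ℕ∞ :=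
  sInf {N : ℕ∞ | ∃ n : ℕ, N = n ∧
    ∃ f : Set.Ioi (0 : ℝ) → Set.Ioi (0 : ℝ), IsDilation f ∧ ∀ G ∈ 𝓒, IsControlFunction n f G}

/-- `(B t : t ∈ τ)` is a tree-decomposition of `G` indexed by the tree `T`
(`SimpleGraph.Connected` includes nonemptiness). -/
structure IsTreeDecomposition {V : Type u} {τ : Type v} (G : SimpleGraph V) (T : SimpleGraph τ)
    (B : τ → Set V) : Prop where
  isTree : T.IsTree
  connected : ∀ x : V, (T.induce {t | x ∈ B t}).Connected
  edge_mem : ∀ x y : V, G.Adj x y → ∃ t, x ∈ B t ∧ y ∈ B t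

/-- The adhesion: the maximal size of the intersection of two adjacent bags (`0` if there are no
adjacent bags). -/
noncomputable def adhesion {V : Type u} {τ : Type v} (T : SimpleGraph τ) (B : τ → Set V) : ℕ∞ :=
  ⨆ (t : τ) (t' : τ) (_ : T.Adj t t'), (B t ∩ B t').encard

/-- The (unweighted) torso at `t`: the graph induced by the bag `B t`, with an edge added between
any two distinct vertices in the intersection of `B t` with an adjacent bag. -/
def torso {V : Type u} {τ : Type v} (G : SimpleGraph V) (T : SimpleGraph τ) (B : τ → Set V)
    (t : τ) : SimpleGraph (B t) where
  Adj x y := x ≠ y ∧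
    (G.Adj x.1 y.1 ∨ ∃ t', T.Adj t t' ∧ x.1 ∈ B t ∩ B t' ∧ y.1 ∈ B t ∩ B t')
  symm := ⟨fun _ _ h => ⟨h.1.symm, h.2.imp (fun a => a.symm) fun ⟨t', a, b, c⟩ => ⟨t', a, c, b⟩⟩⟩
  loopless := ⟨fun _ h => h.1 rfl⟩

/-- The weighted torso at `t`: the torso, in which each edge `xy` has as weight the distance of
`x` and `y` in the whole weighted graph `G`. -/
noncomputable def weightedTorso {τ : Type v} (G : WeightedGraph.{u}) (T : SimpleGraph τ)
    (B : τ → Set G.V) (t : τ) : WeightedGraph.{u} where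
  V := B t
  finite := inferInstance
  graph := torso G.graph T B t
  weight {x y} _ := G.dist x.1 y.1
  weight_symm {x y} _ := G.dist_comm y.1 x.1
  weight_pos {_ _} h := G.dist_pos fun e => h.1 (Subtype.ext e)

/-- `(B t : t ∈ τ)` is a `(k, 𝓗)`-construction of `G`: a tree-decomposition of adhesion at most
`k` all of whose weighted torsos are in `𝓗`. -/
structure IsConstruction {τ : Type v} (k : ℕ) (𝓗 : Set WeightedGraph.{u})
    (G : WeightedGraph.{u}) (T : SimpleGraph τ) (B : τ → Set G.V) : Prop where
  isTreeDecomposition : IsTreeDecomposition G.graph T B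
  adhesion_le : adhesion T B ≤ k
  weightedTorso_mem : ∀ t, G.weightedTorso T B t ∈ 𝓗

/-- `G` is `(k, 𝓗)`-constructable: it admits a `(k, 𝓗)`-construction indexed by a finite tree. -/
def IsConstructable (k : ℕ) (𝓗 : Set WeightedGraph.{u}) (G : WeightedGraph.{u}) : Prop :=
  ∃ (τ : Type) (_ : Finite τ) (T : SimpleGraph τ) (B : τ → Set G.V), IsConstruction k 𝓗 G T B

end WeightedGraph

/-! Fix `r`, root the tree, and colour branches from the leaves upward. The claim is strengthened so
that any colouring `g` of the adhesion set at `s` extends to the branch at `s` (`IsExtension`).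
Points within `r` of the adhesion set copy the colour of a nearby adhesion point; the shell from `r`
to `2r` gets colour `a`, the shell from `2r` to `3r` colour `b`. No monochromatic step crosses the
boundary at `2r`. This barrier needs two colours, whence the maximum with 1.

Let `F` be the `3r`-neighbourhood of the adhesion set. The stage at `s` is the subtree reached
through adhesion sets meeting `F`. With `F` deleted, each of its adhesion sets loses a point, so
induction on the adhesion bound colours the stage, at a scale larger by a constant factor
(`exists_colourable`). Below the stage hang branches whose adhesion sets miss `F`; each is coloured
by extending the stage colouring of its adhesion set.

Monochromatic chains are then of three kinds. Those near the adhesion set at `s` lie in at most `k`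
balls (`rel_of_chain_near`). Those deep in a hanging branch stay there and inherit its bound `K`
unchanged, so nothing accumulates with the height of the tree. The others project to chains in the
stage (`rel_of_chain_stage`), except close to the adhesion set at `s`, where covering by balls
applies again.

Distances are always those of the whole graph, even after points are deleted: a chain pays the true
distance for a step inside a bag (`Reach`), as in a weighted torso. Torso distances are the true
ones (`dist_weightedTorso_le`), so colourings of torsos serve as colourings of bags. -/

namespace TreeColouring

open Relation

/-! ### Distance relations and chains through bags -/

/-- A family of relations `rel a x y`, to be read as `x` and `y` are at distance at most `a`. -/
structure ScaleRel (V : Type u) where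
  /-- being at distance at most `a` -/
  rel : ℝ → V → V → Prop
  nonneg : ∀ {a x y}, rel a x y → 0 ≤ a
  refl : ∀ {a} x, 0 ≤ a → rel a x x
  symm : ∀ {a x y}, rel a x y → rel a y x
  mono : ∀ {a b x y}, a ≤ b → rel a x y → rel b x y
  trans : ∀ {a b x y z}, rel a x y → rel b y z → rel (a + b) x z

variable {V : Type u} {τ : Type v}

/-- `x` and `y` are joined by a chain of total length at most `ρ`, each of whose steps stays inside
one of the sets `B t`. -/
inductive Reach (D : ScaleRel V) (B : τ → Set V) : ℝ → V → V → Prop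
  | refl {ρ : ℝ} (x : V) (h : 0 ≤ ρ) : Reach D B ρ x x
  | step {a b ρ : ℝ} {x y z : V} (t : τ) (hx : x ∈ B t) (hy : y ∈ B t) (h : D.rel a x y)
      (h' : Reach D B b y z) (hab : a + b ≤ ρ) : Reach D B ρ x z

namespace Reach

variable {D : ScaleRel V} {B : τ → Set V} {a b : ℝ} {x y z : V}

theorem mono (hab : a ≤ b) (h : Reach D B a x y) : Reach D B b x y := by
  cases h with
  | refl _ h => exact .refl _ (h.trans hab)
  | step t hx hy h h' h'' => exact .step t hx hy h h' (h''.trans hab)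

theorem rel (h : Reach D B a x y) : D.rel a x y := by
  induction h with
  | refl x h => exact D.refl x h
  | step t hx hy h h' hab ih => exact D.mono hab (D.trans h ih)

theorem nonneg (h : Reach D B a x y) : 0 ≤ a := D.nonneg h.rel

theorem of_mem {t : τ} (hx : x ∈ B t) (hy : y ∈ B t) (h : D.rel a x y) : Reach D B a x y :=
  .step t hx hy h (.refl y le_rfl) (by simp)

theorem trans (h : Reach D B a x y) (h' : Reach D B b y z) : Reach D B (a + b) x z := by
  induction h with
  | refl x h => exact h'.mono (by linarith)
  | step t hx hy h _ hab ih => exact .step t hx hy h (ih h') (by linarith)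

theorem symm (h : Reach D B a x y) : Reach D B a y x := by
  induction h with
  | refl x h => exact .refl x h
  | step t hx hy h _ hab ih =>
    exact (ih.trans (of_mem hy hx (D.symm h))).mono (by linarith)

theorem eq_or_mem (h : Reach D B a x y) : x = y ∨ ∃ t, x ∈ B t := by
  cases h with
  | refl _ h => exact .inl rfl
  | step t hx hy h h' h'' => exact .inr ⟨t, hx⟩

end Reach

/-- There is a colouring with `m` colours in which monochromatic chains with steps of length at
most `r` have ends at distance at most `K`. -/
def Colourable (D : ScaleRel V) (B : τ → Set V) (m : ℕ) (r K : ℝ) : Prop :=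
  ∃ c : V → Fin m, ∀ x y,
    ReflTransGen (fun x y => c x = c y ∧ Reach D B r x y) x y → D.rel K x y

/-- Every single set `B t` has `m`-colourings with linear control `C`. -/
def BagsColourable (D : ScaleRel V) (B : τ → Set V) (m : ℕ) (C : ℝ) : Prop :=
  ∀ t, ∀ r : ℝ, 0 < r → ∃ c : V → Fin m, ∀ x y,
    ReflTransGen (fun x y => x ∈ B t ∧ y ∈ B t ∧ c x = c y ∧ D.rel r x y) x y → D.rel (C * r) x y

theorem BagsColourable.mono {D : ScaleRel V} {B B' : τ → Set V} {m : ℕ} {C : ℝ}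
    (h : BagsColourable D B m C) (hB : ∀ t, B' t ⊆ B t) : BagsColourable D B' m C := by
  intro t r hr
  obtain ⟨c, hc⟩ := h t r hr
  exact ⟨c, fun x y hxy => hc x y (ReflTransGen.mono (fun _ _ h => ⟨hB t h.1, hB t h.2.1, h.2.2⟩) _ _ hxy)⟩

/-! ### General facts about chains -/

/-- A chain with steps of length at most `r` that stays within distance `ρ` of `k` points has ends
at distance at most `k (2ρ + r)`. -/
theorem rel_of_chain_near_finset (D : ScaleRel V) {r ρ : ℝ} {R : V → V → Prop}
    (hr : 0 ≤ r) (hρ : 0 ≤ ρ) (hR : ∀ x y, R x y → D.rel r x y) (k : ℕ) :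
    ∀ (A : Finset V), A.card ≤ k → ∀ x y, (∃ z ∈ A, D.rel ρ z x) →
      ReflTransGen (fun x y => R x y ∧ (∃ z ∈ A, D.rel ρ z x) ∧ ∃ z ∈ A, D.rel ρ z y) x y →
      D.rel (k * (2 * ρ + r)) x y := by
  classical
  induction k with
  | zero =>
    intro A hA x y ⟨z, hz, _⟩
    simp only [Nat.le_zero, Finset.card_eq_zero] at hA
    simp [hA] at hz
  | succ k ih =>
    intro A hA x y ⟨z, hz, hzx⟩ hxy
    have hcard : (A.erase z).card ≤ k := by
      rw [Finset.card_erase_of_mem hz]; omega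
    have hpos : 0 ≤ (k : ℝ) * (2 * ρ + r) := by positivity
    have near : ∀ w, (∃ z' ∈ A, D.rel ρ z' w) → ¬ D.rel ρ z w → ∃ z' ∈ A.erase z, D.rel ρ z' w := by
      rintro w ⟨z', hz', h⟩ hw
      exact ⟨z', Finset.mem_erase.2 ⟨fun e => hw (e ▸ h), hz'⟩, h⟩
    -- Cut at the last visit to the ball around `z`: the rest of the chain needs only the other
    -- centres. Each centre thus costs `2ρ + r`.
    have key : D.rel ρ z y ∨ (∃ w w', D.rel ρ z w ∧ R w w' ∧ (∃ z' ∈ A.erase z, D.rel ρ z' w') ∧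
        ReflTransGen (fun x y => R x y ∧ (∃ z' ∈ A.erase z, D.rel ρ z' x) ∧
          ∃ z' ∈ A.erase z, D.rel ρ z' y) w' y) := by
      induction hxy with
      | refl => exact .inl hzx
      | tail _ hstep ih' =>
        rename_i y y1 _
        by_cases h1 : D.rel ρ z y1
        · exact .inl h1
        by_cases h0 : D.rel ρ z y
        · exact .inr ⟨y, y1, h0, hstep.1, near _ hstep.2.2 h1, .refl⟩
        · rcases ih' with h | ⟨w, w', hw, hww', hw', h⟩
          · exact absurd h h0
          · exact .inr ⟨w, w', hw, hww', hw',
              h.tail ⟨hstep.1, near _ hstep.2.1 h0, near _ hstep.2.2 h1⟩⟩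
    push_cast
    rcases key with h | ⟨w, w', hw, hww', hw', h⟩
    · exact D.mono (by linarith) (D.trans (D.symm hzx) h)
    · exact D.mono (by linarith)
        (D.trans (D.trans (D.trans (D.symm hzx) hw) (hR _ _ hww')) (ih _ hcard _ _ hw' h))

theorem rel_of_chain_near (D : ScaleRel V) {r ρ : ℝ} {R : V → V → Prop}
    (hr : 0 ≤ r) (hρ : 0 ≤ ρ) (hR : ∀ x y, R x y → D.rel r x y) {k : ℕ} {A : Set V}
    (hfin : A.Finite) (hA : A.ncard ≤ k) {x y : V} (hx : ∃ z ∈ A, D.rel ρ z x)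
    (h : ReflTransGen (fun x y => R x y ∧ (∃ z ∈ A, D.rel ρ z x) ∧ ∃ z ∈ A, D.rel ρ z y) x y) :
    D.rel (k * (2 * ρ + r)) x y := by
  lift A to Finset V using hfin
  rw [Set.ncard_coe_finset] at hA
  exact rel_of_chain_near_finset D hr hρ hR k A hA x y (by simpa using hx) (by simpa using h)

/-- A predicate preserved by the steps of a chain may be added to the steps. -/
theorem chain_restrict {R : V → V → Prop} {P : V → Prop} (hP : ∀ x y, P x → R x y → P y)
    {x y : V} (hx : P x) (h : ReflTransGen R x y) :
    ReflTransGen (fun x y => R x y ∧ P x ∧ P y) x y ∧ P y := by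
  induction h with
  | refl => exact ⟨.refl, hx⟩
  | tail _ h ih => exact ⟨ih.1.tail ⟨h, ih.2, hP _ _ ih.2 h⟩, hP _ _ ih.2 h⟩

/-- A chain with an end in `E` has an initial segment avoiding `E` followed by a step into `E`. -/
theorem chain_first_hit {R : V → V → Prop} (E : Set V) {x y : V} (h : ReflTransGen R x y)
    (hy : y ∈ E) : x ∈ E ∨ ∃ w w', ReflTransGen (fun x y => R x y ∧ x ∉ E ∧ y ∉ E) x w ∧
      R w w' ∧ w' ∈ E := by
  induction h using ReflTransGen.head_induction_on with
  | refl => exact .inl hy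
  | @head a b h _ ih =>
    by_cases ha : a ∈ E
    · exact .inl ha
    right
    by_cases hb : b ∈ E
    · exact ⟨a, b, .refl, h, hb⟩
    · obtain ⟨w, w', h1, h2, h3⟩ := ih.resolve_left hb
      exact ⟨w, w', h1.head ⟨h, ha, hb⟩, h2, h3⟩

/-! ### Rooted trees, branches and adhesion sets -/

/-- `τ` is a rooted tree, ordered by being an ancestor. -/
structure IsRooted [PartialOrder τ] (root : τ) (par : τ → τ) : Prop where
  root_le : ∀ t, root ≤ t
  par_lt : ∀ t, t ≠ root → par t < t
  le_par : ∀ s t, s < t → s ≤ par t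
  le_total : ∀ s s' t : τ, s ≤ t → s' ≤ t → s ≤ s' ∨ s' ≤ s

/-- The connectivity axiom of a tree-decomposition, for a rooted tree. -/
def IsRootedDecomposition [PartialOrder τ] (par : τ → τ) (B : τ → Set V) : Prop :=
  ∀ s t t' x, s ≤ t → ¬ s ≤ t' → x ∈ B t → x ∈ B t' → x ∈ B s ∧ x ∈ B (par s)

section

variable [PartialOrder τ] (D : ScaleRel V) (B : τ → Set V)

/-- The union of the bags at descendants of `s`. -/
def branch (s : τ) : Set V := {x | ∃ t, s ≤ t ∧ x ∈ B t}

/-- The adhesion set at `s`. -/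
def adh (s : τ) : Set V := {x | x ∈ branch B s ∧ ∃ t, ¬ s ≤ t ∧ x ∈ B t}

/-- The part of `branch B s` within distance `ρ` of the adhesion set. -/
def nbhd (ρ : ℝ) (s : τ) : Set V := {x | x ∈ branch B s ∧ ∃ z ∈ adh B s, Reach D B ρ z x}

variable {D B}

theorem nbhd_mono {ρ σ : ℝ} (h : ρ ≤ σ) {s : τ} : nbhd D B ρ s ⊆ nbhd D B σ s :=
  fun _ hx => ⟨hx.1, hx.2.imp fun _ hz => ⟨hz.1, hz.2.mono h⟩⟩

theorem adh_subset_nbhd {ρ : ℝ} (h : 0 ≤ ρ) {s : τ} : adh B s ⊆ nbhd D B ρ s :=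
  fun x hx => ⟨hx.1, x, hx, .refl x h⟩

theorem mem_nbhd_of_reach {ρ σ μ : ℝ} {s : τ} {x y : V} (hx : x ∈ nbhd D B ρ s)
    (hy : y ∈ branch B s) (h : Reach D B σ x y) (hμ : ρ + σ ≤ μ) : y ∈ nbhd D B μ s :=
  ⟨hy, hx.2.imp fun _ hz => ⟨hz.1, (hz.2.trans h).mono hμ⟩⟩

/-- A chain that leaves `branch B s` meets the adhesion set. -/
theorem Reach.exists_mem_adh {ρ : ℝ} {s : τ} {x y : V} (h : Reach D B ρ x y) (hx : x ∈ branch B s)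
    (hy : y ∉ branch B s) : ∃ z ∈ adh B s, Reach D B ρ x z ∧ Reach D B ρ z y := by
  induction h with
  | refl x h => exact absurd hx hy
  | step t hxt hyt h h' hab ih =>
    rename_i a b ρ x x' y
    have ha := D.nonneg h
    have hb := h'.nonneg
    by_cases hx' : x' ∈ branch B s
    · obtain ⟨z, hz, h1, h2⟩ := ih hx' hy
      exact ⟨z, hz, .step t hxt hyt h h1 hab, h2.mono (by linarith)⟩
    · exact ⟨x, ⟨hx, t, fun hst => hx' ⟨t, hst, hyt⟩, hxt⟩, .refl x (by linarith),
        .step t hxt hyt h h' hab⟩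

theorem mem_nbhd_of_reach_of_notMem {ρ : ℝ} {s : τ} {x y : V} (h : Reach D B ρ x y)
    (hx : x ∈ branch B s) (hy : y ∉ branch B s) : x ∈ nbhd D B ρ s := by
  obtain ⟨z, hz, h1, -⟩ := h.exists_mem_adh hx hy
  exact ⟨hx, z, hz, h1.symm⟩

end

/-! ### The stage and the branches hanging from it -/

section

variable [PartialOrder τ] {D : ScaleRel V} {B : τ → Set V} {root : τ} {par : τ → τ}

theorem adh_subset (hB : IsRootedDecomposition par B) {s : τ} {x : V} (hx : x ∈ adh B s) :
    x ∈ B s ∧ x ∈ B (par s) := by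
  obtain ⟨⟨t, ht, hxt⟩, t', ht', hxt'⟩ := hx
  exact hB s t t' x ht ht' hxt hxt'

theorem adh_root (hT : IsRooted root par) : adh B root = ∅ := by
  ext x
  simp only [Set.mem_empty_iff_false, iff_false]
  rintro ⟨-, t, ht, -⟩
  exact ht (hT.root_le t)

variable (B) (par) (F : Set V) (s : τ)

/-- The subtree with top `s` spanned by the descendants whose adhesion set meets `F`. -/
def stage : Set τ := {t | s ≤ t ∧ ∀ w, s < w → w ≤ t → ∃ x ∈ adh B w, x ∈ F}

/-- The bags of the subtree `stage B F s`, with `F` removed. -/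
def stageBag (t : τ) : Set V := {x | x ∈ B t ∧ x ∉ F ∧ t ∈ stage B F s}

/-- The union of the bags of the subtree `stage B F s`, with `F` removed. -/
def stageSet : Set V := {x | ∃ t, x ∈ stageBag B F s t}

/-- The tops of the subtrees hanging from `stage B F s`. -/
def hanging : Set τ := {v | s < v ∧ par v ∈ stage B F s ∧ ∀ x ∈ adh B v, x ∉ F}

variable {B} {par} {F} {s}

theorem stageBag_subset (t : τ) : stageBag B F s t ⊆ B t := fun _ h => h.1

theorem exists_hanging_le [Finite τ] (hT : IsRooted root par) {u : τ} (hsu : s ≤ u)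
    (hu : u ∉ stage B F s) : ∃ v ∈ hanging B par F s, v ≤ u := by
  have hne : {w | s < w ∧ w ≤ u ∧ ∀ x ∈ adh B w, x ∉ F}.Nonempty := by
    by_contra hcon
    refine hu ⟨hsu, fun w hw hwu => ?_⟩
    by_contra! h
    exact hcon ⟨w, hw, hwu, h⟩
  obtain ⟨v, hv⟩ := (Set.toFinite {w | s < w ∧ w ≤ u ∧ ∀ x ∈ adh B w, x ∉ F}).exists_minimal hne
  have hlt : par v < v := hT.par_lt v fun e => (hv.prop.1.trans_le (e ▸ hT.root_le s)).false
  refine ⟨v, ⟨hv.prop.1, ⟨hT.le_par _ _ hv.prop.1, fun w hw hwv => ?_⟩, hv.prop.2.2⟩, hv.prop.2.1⟩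
  by_contra! h
  exact hv.not_lt ⟨hw, (hwv.trans hlt.le).trans hv.prop.2.1, h⟩ (hwv.trans_lt hlt)

theorem not_le_of_mem_stage {u v : τ} (hv : v ∈ hanging B par F s) (hu : u ∈ stage B F s) :
    ¬ v ≤ u := fun h => by
  obtain ⟨x, hx, hxF⟩ := hu.2 v hv.1 h
  exact hv.2.2 x hx hxF

theorem eq_of_hanging_le (hT : IsRooted root par) {v v' t : τ} (hv : v ∈ hanging B par F s)
    (hv' : v' ∈ hanging B par F s) (h : v ≤ t) (h' : v' ≤ t) : v = v' := by
  by_contra hne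
  rcases hT.le_total v v' t h h' with hle | hle
  · exact not_le_of_mem_stage hv hv'.2.1 (hT.le_par _ _ (lt_of_le_of_ne hle hne))
  · exact not_le_of_mem_stage hv' hv.2.1 (hT.le_par _ _ (lt_of_le_of_ne hle (Ne.symm hne)))

theorem mem_adh_of_mem_branch (hT : IsRooted root par) {v v' : τ} (hv : v ∈ hanging B par F s)
    (hv' : v' ∈ hanging B par F s) (hne : v ≠ v') {x : V} (hx : x ∈ branch B v)
    (hx' : x ∈ branch B v') : x ∈ adh B v := by
  obtain ⟨t', ht', hxt'⟩ := hx'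
  exact ⟨hx, t', fun h => hne (eq_of_hanging_le hT hv hv' h ht'), hxt'⟩

theorem mem_stageBag_of_mem_adh (hB : IsRootedDecomposition par B) {v : τ}
    (hv : v ∈ hanging B par F s) {x : V} (hx : x ∈ adh B v) : x ∈ stageBag B F s (par v) :=
  ⟨(adh_subset hB hx).2, hv.2.2 x hx, hv.2.1⟩

theorem mem_stageSet_of_mem_adh (hB : IsRootedDecomposition par B) {v : τ}
    (hv : v ∈ hanging B par F s) {x : V} (hx : x ∈ adh B v) : x ∈ stageSet B F s :=
  ⟨_, mem_stageBag_of_mem_adh hB hv hx⟩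

theorem mem_adh_of_mem_stageSet {v : τ} (hv : v ∈ hanging B par F s) {x : V}
    (hx : x ∈ stageSet B F s) (hxv : x ∈ branch B v) : x ∈ adh B v := by
  obtain ⟨u, hu⟩ := hx
  exact ⟨hxv, u, not_le_of_mem_stage hv hu.2.2, hu.1⟩

theorem stageSet_subset_branch {x : V} (hx : x ∈ stageSet B F s) : x ∈ branch B s := by
  obtain ⟨u, hu⟩ := hx
  exact ⟨u, hu.2.2.1, hu.1⟩

theorem branch_subset {v : τ} (h : s ≤ v) : branch B v ⊆ branch B s :=
  fun _ ⟨t, ht, hx⟩ => ⟨t, h.trans ht, hx⟩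

theorem branch_cover [Finite τ] (hT : IsRooted root par) {x : V} (hx : x ∈ branch B s) :
    x ∈ F ∨ x ∈ stageSet B F s ∨ ∃ v ∈ hanging B par F s, x ∈ branch B v := by
  obtain ⟨t, hst, hxt⟩ := hx
  by_cases hxF : x ∈ F
  · exact .inl hxF
  by_cases ht : t ∈ stage B F s
  · exact .inr (.inl ⟨t, hxt, hxF, ht⟩)
  · obtain ⟨v, hv, hvt⟩ := exists_hanging_le hT hst ht
    exact .inr (.inr ⟨v, hv, t, hvt, hxt⟩)

/-- A chain from the adhesion set at `s` into a hanging branch meets the adhesion set at `v`, which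
would then contain a point of the neighbourhood. So the colours prescribed near `s` never conflict
with those of a hanging branch. -/
theorem notMem_of_mem_hanging_branch {ρ : ℝ} (hρ : 0 ≤ ρ)
    {v : τ} (hv : v ∈ hanging B par (nbhd D B ρ s) s) {x : V} (hx : x ∈ branch B v) :
    x ∉ nbhd D B ρ s := by
  rintro ⟨-, z, hz, hzx⟩
  by_cases hzv : z ∈ branch B v
  · refine hv.2.2 z ?_ (adh_subset_nbhd hρ hz)
    obtain ⟨-, t, ht, hzt⟩ := hz
    exact ⟨hzv, t, fun h => ht (hv.1.le.trans h), hzt⟩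
  · obtain ⟨w, hw, h1, h2⟩ := hzx.symm.exists_mem_adh hx hzv
    exact hv.2.2 w hw ⟨branch_subset hv.1.le hw.1, z, hz, h2.symm⟩

/-- The stage is a subtree, so an edge separating two of its nodes has both ends in it. The second
part supplies the point of `F` that an adhesion set loses. -/
theorem stageBag_isRootedDecomposition (hT : IsRooted root par) (hB : IsRootedDecomposition par B) :
    IsRootedDecomposition par (stageBag B F s) ∧
      ∀ w, (adh (stageBag B F s) w).Nonempty → s < w ∧ ∃ x ∈ adh B w, x ∈ F := by
  have key : ∀ w t t', w ≤ t → ¬ w ≤ t' → t ∈ stage B F s → t' ∈ stage B F s →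
      s < w ∧ w ∈ stage B F s ∧ par w ∈ stage B F s := by
    intro w t t' hwt hwt' ht ht'
    have hsw : s < w := by
      rcases hT.le_total s w t ht.1 hwt with h | h
      · exact lt_of_le_of_ne h fun e => hwt' (e ▸ ht'.1)
      · exact absurd (h.trans ht'.1) hwt'
    have hw : w ∈ stage B F s := ⟨hsw.le, fun w' h h' => ht.2 w' h (h'.trans hwt)⟩
    have hlt : par w < w := hT.par_lt w fun e => (hsw.trans_le (e ▸ hT.root_le s)).false
    exact ⟨hsw, hw, hT.le_par _ _ hsw, fun w' h h' => hw.2 w' h (h'.trans hlt.le)⟩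
  refine ⟨fun w t t' x hwt hwt' hx hx' => ?_, ?_⟩
  · obtain ⟨-, h1, h2⟩ := key w t t' hwt hwt' hx.2.2 hx'.2.2
    obtain ⟨h3, h4⟩ := hB w t t' x hwt hwt' hx.1 hx'.1
    exact ⟨⟨h3, hx.2.1, h1⟩, h4, hx.2.1, h2⟩
  · rintro w ⟨x, ⟨t, hwt, hx⟩, t', hwt', hx'⟩
    obtain ⟨h0, h1, -⟩ := key w t t' hwt hwt' hx.2.2 hx'.2.2
    exact ⟨h0, h1.2 w h0 le_rfl⟩

/-- A nonempty adhesion set of the stage arises from one of `B` that met `F`, and so lost a point.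
This drop drives the induction on adhesion. -/
theorem ncard_adh_stageBag_le [Finite V] (hT : IsRooted root par)
    (hB : IsRootedDecomposition par B) {k : ℕ} (hk : ∀ w, (adh B w).ncard ≤ k + 1) (w : τ) :
    (adh (stageBag B F s) w).ncard ≤ k := by
  rcases Set.eq_empty_or_nonempty (adh (stageBag B F s) w) with h | h
  · simp [h]
  obtain ⟨-, x, hx, hxF⟩ := (stageBag_isRootedDecomposition hT hB).2 w h
  have hss : adh (stageBag B F s) w ⊂ adh B w := by
    refine ⟨fun y hy => ?_, fun hsub => ?_⟩
    · obtain ⟨⟨t, ht, hyt⟩, t', ht', hyt'⟩ := hy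
      exact ⟨⟨t, ht, hyt.1⟩, t', ht', hyt'.1⟩
    · obtain ⟨⟨t, ht, hyt⟩, -⟩ := hsub hx
      exact hyt.2.1 hxF
  have := Set.ncard_lt_ncard hss (Set.toFinite _)
  have := hk w
  omega

/-- A chain between points of `stageSet B F s`, where `F` contains the adhesion set at `s`, either
passes through `F` or may be rerouted inside the bags of `stageBag B F s`. -/
theorem Reach.stage_or_through [Finite τ] (hT : IsRooted root par)
    (hB : IsRootedDecomposition par B) (hF : adh B s ⊆ F) {ρ : ℝ} {x y : V}
    (h : Reach D B ρ x y) (hx : x ∈ stageSet B F s) (hy : y ∈ stageSet B F s) :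
    Reach D (stageBag B F s) ρ x y ∨ ∃ f ∈ F, Reach D B ρ x f ∧ Reach D B ρ f y := by
  -- An excursion into a hanging branch that starts in the stage begins and ends in the adhesion set
  -- at `v`, hence in the bag of `par v`; one step replaces it.
  have hcl : ∀ {ρ : ℝ} {x : V}, x ∈ stageSet B F s →
      (∃ v ∈ hanging B par F s, x ∈ branch B v ∧ ∃ z ∈ adh B v, ∃ a b,
        D.rel a x z ∧ Reach D (stageBag B F s) b z y ∧ a + b ≤ ρ) →
      Reach D (stageBag B F s) ρ x y := by
    rintro ρ x hx ⟨v, hv, hxv, z, hz, a, b, h1, h2, hab⟩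
    exact .step (par v) (mem_stageBag_of_mem_adh hB hv (mem_adh_of_mem_stageSet hv hx hxv))
      (mem_stageBag_of_mem_adh hB hv hz) h1 h2 hab
  -- For the induction the start may also lie inside a hanging branch; the exit `z` and the distance
  -- to it are then recorded.
  have key : (∃ f ∈ F, Reach D B ρ x f ∧ Reach D B ρ f y) ∨
      (x ∈ stageSet B F s ∧ Reach D (stageBag B F s) ρ x y) ∨
      (∃ v ∈ hanging B par F s, x ∈ branch B v ∧ ∃ z ∈ adh B v, ∃ a b,
        D.rel a x z ∧ Reach D (stageBag B F s) b z y ∧ a + b ≤ ρ) := by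
    clear hx
    induction h with
    | refl x h => exact .inr (.inl ⟨hy, .refl x h⟩)
    | @step a b ρ x x' y u hxu hx'u h h' hab ih =>
      have ha := D.nonneg h
      have hb := h'.nonneg
      have hxx' : Reach D B ρ x x' := (Reach.of_mem hxu hx'u h).mono (by linarith)
      have hx'y : Reach D B ρ x' y := h'.mono (by linarith)
      have hxy : Reach D B ρ x y := .step u hxu hx'u h h' hab
      rcases ih hy hcl with ⟨f, hf, h1, h2⟩ | ih
      · exact .inl ⟨f, hf, .step u hxu hx'u h h1 hab, h2.mono (by linarith)⟩
      by_cases hx'F : x' ∈ F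
      · exact .inl ⟨x', hx'F, hxx', hx'y⟩
      by_cases hxF : x ∈ F
      · exact .inl ⟨x, hxF, .refl x (by linarith), hxy⟩
      by_cases hsu : s ≤ u
      · by_cases hu : u ∈ stage B F s
        · have hxm : x ∈ stageBag B F s u := ⟨hxu, hxF, hu⟩
          have hx'm : x' ∈ stageBag B F s u := ⟨hx'u, hx'F, hu⟩
          have : Reach D (stageBag B F s) b x' y := by
            rcases ih with ih | ih
            · exact ih.2
            · exact hcl ⟨u, hx'm⟩ ih
          exact .inr (.inl ⟨⟨u, hxm⟩, .step u hxm hx'm h this hab⟩)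
        · obtain ⟨v, hv, hvu⟩ := exists_hanging_le hT hsu hu
          refine .inr (.inr ⟨v, hv, ⟨u, hvu, hxu⟩, ?_⟩)
          have fromStage : x' ∈ stageSet B F s → Reach D (stageBag B F s) b x' y →
              ∃ z ∈ adh B v, ∃ a b,
                D.rel a x z ∧ Reach D (stageBag B F s) b z y ∧ a + b ≤ ρ := fun h1 h2 =>
            ⟨x', mem_adh_of_mem_stageSet hv h1 ⟨u, hvu, hx'u⟩, a, b, h, h2, hab⟩
          rcases ih with ih | ih
          · exact fromStage ih.1 ih.2
          · by_cases hst : x' ∈ stageSet B F s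
            · exact fromStage hst (hcl hst ih)
            obtain ⟨v', hv', hx'v', z, hz, a', b', h1, h2, hab'⟩ := ih
            by_cases hvv' : v = v'
            · subst hvv'
              exact ⟨z, hz, a + a', b', D.trans h h1, h2, by linarith⟩
            · exact absurd (mem_stageSet_of_mem_adh hB hv
                (mem_adh_of_mem_branch hT hv hv' hvv' ⟨u, hvu, hx'u⟩ hx'v')) hst
      -- The step uses a bag outside the branch at `s`, so the chain meets the adhesion set at `s`,
      -- at `x'` or on its way back to `y`.
      · by_cases hx's : x' ∈ branch B s
        · exact absurd (hF ⟨hx's, u, hsu, hx'u⟩) hx'F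
        · obtain ⟨z, hz, h1, h2⟩ := h'.symm.exists_mem_adh (stageSet_subset_branch hy) hx's
          exact .inl ⟨z, hF hz, .step u hxu hx'u h h2.symm hab, h1.symm.mono (by linarith)⟩
  rcases key with h | h | h
  · exact .inr h
  · exact .inl h.2
  · exact .inl (hcl hx h)

end

/-! ### Extending a colouring from an adhesion set to its branch -/

section

variable [PartialOrder τ] {D : ScaleRel V} {B : τ → Set V} {root : τ} {par : τ → τ}

/-- Two points of `branch B s` of the same colour that are at distance at most `r`. -/
def Mono (D : ScaleRel V) (B : τ → Set V) {m : ℕ} (r : ℝ) (s : τ) (c : V → Fin m) (x y : V) :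
    Prop :=
  x ∈ branch B s ∧ y ∈ branch B s ∧ c x = c y ∧ Reach D B r x y

theorem Mono.symm {m : ℕ} {r : ℝ} {s : τ} {c : V → Fin m} {x y : V} (h : Mono D B r s c x y) :
    Mono D B r s c y x :=
  ⟨h.2.1, h.1, h.2.2.1.symm, h.2.2.2.symm⟩

/-- The colouring `c` of `branch B s` extends the colouring `g` of the adhesion set at `s`, it is
given by `g` near the adhesion set, and monochromatic chains do not leave the neighbourhood of the
adhesion set. -/
structure IsExtension (D : ScaleRel V) (B : τ → Set V) {m : ℕ} (r K : ℝ) (s : τ)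
    (g c : V → Fin m) : Prop where
  eq_adh : ∀ x ∈ adh B s, c x = g x
  exists_proj : ∀ x ∈ nbhd D B r s, ∃ z ∈ adh B s, Reach D B r z x ∧ c x = g z
  closed : ∀ x y, x ∈ nbhd D B (2 * r) s → Mono D B r s c x y → y ∈ nbhd D B (2 * r) s
  bounded : ∀ x y, ReflTransGen (Mono D B r s c) x y → D.rel K x y

/-- The colouring of a branch at `s`, assembled from a colouring `cY` of the stage and colourings
`cv` of the hanging branches. -/
theorem exists_assembled_colouring (hT : IsRooted root par)
    (hB : IsRootedDecomposition par B) {m : ℕ} (a b : Fin m) {r : ℝ} (hr : 0 < r) (s : τ)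
    (g cY : V → Fin m) (cv : τ → V → Fin m)
    (hcv : ∀ v ∈ hanging B par (nbhd D B (3 * r) s) s, ∀ x ∈ adh B v, cv v x = cY x) :
    ∃ c : V → Fin m, (∀ x ∈ adh B s, c x = g x) ∧
      (∀ x ∈ nbhd D B r s, ∃ z ∈ adh B s, Reach D B r z x ∧ c x = g z) ∧
      (∀ x ∈ nbhd D B (2 * r) s, x ∉ nbhd D B r s → c x = a) ∧
      (∀ x ∈ nbhd D B (3 * r) s, x ∉ nbhd D B (2 * r) s → c x = b) ∧
      (∀ x ∈ stageSet B (nbhd D B (3 * r) s) s, c x = cY x) ∧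
      ∀ v ∈ hanging B par (nbhd D B (3 * r) s) s, ∀ x ∈ branch B v, c x = cv v x := by
  classical
  have hproj : ∀ x, ∃ z, x ∈ nbhd D B r s → z ∈ adh B s ∧ Reach D B r z x := fun x => by
    by_cases hx : x ∈ nbhd D B r s
    · obtain ⟨z, hz⟩ := hx.2
      exact ⟨z, fun _ => hz⟩
    · exact ⟨x, fun h => absurd h hx⟩
  choose p hp using hproj
  have h0 : adh B s ⊆ nbhd D B r s := adh_subset_nbhd hr.le
  have h12 : nbhd D B r s ⊆ nbhd D B (2 * r) s := nbhd_mono (by linarith)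
  have h23 : nbhd D B (2 * r) s ⊆ nbhd D B (3 * r) s := nbhd_mono (by linarith)
  -- The adhesion set comes first: `p` need not fix its points, but there the colour must be exactly
  -- `g`.
  let c : V → Fin m := fun x =>
    if x ∈ adh B s then g x else if x ∈ nbhd D B r s then g (p x)
    else if x ∈ nbhd D B (2 * r) s then a else if x ∈ nbhd D B (3 * r) s then b
    else if x ∈ stageSet B (nbhd D B (3 * r) s) s then cY x
    else if h : ∃ v ∈ hanging B par (nbhd D B (3 * r) s) s, x ∈ branch B v then cv h.choose x
    else a
  have hF : ∀ x, x ∉ nbhd D B (3 * r) s → c x =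
      if x ∈ stageSet B (nbhd D B (3 * r) s) s then cY x
      else if h : ∃ v ∈ hanging B par (nbhd D B (3 * r) s) s, x ∈ branch B v then cv h.choose x
      else a := fun x h3 => by
    have h2 : x ∉ nbhd D B (2 * r) s := fun h => h3 (h23 h)
    have h1 : x ∉ nbhd D B r s := fun h => h2 (h12 h)
    have h0 : x ∉ adh B s := fun h => h1 (h0 h)
    simp only [c, if_neg h0, if_neg h1, if_neg h2, if_neg h3]
  have hY : ∀ x ∈ stageSet B (nbhd D B (3 * r) s) s, c x = cY x := fun x hx => by
    have h3 : x ∉ nbhd D B (3 * r) s := by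
      obtain ⟨u, hu⟩ := hx
      exact hu.2.1
    rw [hF x h3, if_pos hx]
  refine ⟨c, fun x hx => by simp only [c, if_pos hx], fun x hx => ?_, fun x hx hx' => ?_,
    fun x hx hx' => ?_, hY, fun v hv x hx => ?_⟩
  · by_cases hxa : x ∈ adh B s
    · exact ⟨x, hxa, .refl x hr.le, by simp only [c, if_pos hxa]⟩
    · exact ⟨p x, (hp x hx).1, (hp x hx).2, by simp only [c, if_neg hxa, if_pos hx]⟩
  · simp only [c, if_neg (fun h => hx' (h0 h)), if_neg hx', if_pos hx]
  · simp only [c, if_neg (fun h => hx' (h12 (h0 h))), if_neg (fun h => hx' (h12 h)), if_neg hx',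
      if_pos hx]
  · by_cases hxY : x ∈ stageSet B (nbhd D B (3 * r) s) s
    · rw [hY x hxY, hcv v hv x (mem_adh_of_mem_stageSet hv hxY hx)]
    · have hex : ∃ v ∈ hanging B par (nbhd D B (3 * r) s) s, x ∈ branch B v := ⟨v, hv, hx⟩
      -- A point in two hanging branches lies in an adhesion set, hence in the stage; outside the
      -- stage the choice is forced.
      have heq : hex.choose = v := by
        by_contra hne
        exact hxY (mem_stageSet_of_mem_adh hB hv
          (mem_adh_of_mem_branch hT hv hex.choose_spec.1 (Ne.symm hne) hx hex.choose_spec.2))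
      rw [hF x (notMem_of_mem_hanging_branch (by positivity) hv hx), if_neg hxY, dif_pos hex, heq]

/-- Monochromatic chains within the neighbourhood of an adhesion set are bounded. -/
theorem rel_of_chain_nbhd [Finite V] {m : ℕ} {r : ℝ} (hr : 0 < r) {s t : τ} {k : ℕ}
    (hk : (adh B t).ncard ≤ k) {c : V → Fin m} {x y : V} (hx : x ∈ nbhd D B (2 * r) t)
    (h : ReflTransGen (fun x y => Mono D B r s c x y ∧ x ∈ nbhd D B (2 * r) t ∧
      y ∈ nbhd D B (2 * r) t) x y) :
    D.rel (k * (2 * (2 * r) + r)) x y := by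
  have hn : ∀ {x}, x ∈ nbhd D B (2 * r) t → ∃ z ∈ adh B t, D.rel (2 * r) z x :=
    fun hx => hx.2.imp fun _ h => ⟨h.1, h.2.rel⟩
  exact rel_of_chain_near D hr.le (by positivity) (fun _ _ h => h.2.2.2.rel) (Set.toFinite _) hk
    (hn hx) (ReflTransGen.mono (fun _ _ h => ⟨h.1, hn h.2.1, hn h.2.2⟩) _ _ h)

/-- Monochromatic chains that stay near the stage and away from the adhesion set at `s` are
bounded. -/
theorem rel_of_chain_stage [Finite V] [Finite τ] (hT : IsRooted root par)
    (hB : IsRootedDecomposition par B) {m : ℕ} {r : ℝ} (hr : 0 < r) {k : ℕ}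
    (hk : ∀ w, (adh B w).ncard ≤ k) (s : τ) {c cY : V → Fin m} {E S : ℝ}
    (hY : ∀ x y, ReflTransGen (fun x y => cY x = cY y ∧
      Reach D (stageBag B (nbhd D B (3 * r) s) s) (k * (2 * (2 * r) + r) + 3 * r) x y) x y →
      D.rel E x y)
    (hE : 0 ≤ E) (hS : E + 2 * (k * (2 * (2 * r) + r) + r) ≤ S)
    (hcY : ∀ x ∈ stageSet B (nbhd D B (3 * r) s) s, c x = cY x)
    (hproj : ∀ v ∈ hanging B par (nbhd D B (3 * r) s) s, ∀ x ∈ nbhd D B r v,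
      ∃ z ∈ adh B v, Reach D B r z x ∧ c x = cY z)
    {Z : Set V} (hZs : ∀ x ∈ Z, x ∈ branch B s)
    (hZv : ∀ x ∈ Z, ∀ v ∈ hanging B par (nbhd D B (3 * r) s) s, x ∈ branch B v →
      x ∈ nbhd D B (2 * r) v)
    (hZE : ∀ x ∈ Z, ∀ z ∈ adh B s, ¬ Reach D B (7 * r) z x) {x₀ x : V} (hx₀ : x₀ ∈ Z)
    (h : ReflTransGen (fun x y => Mono D B r s c x y ∧ x ∈ Z ∧ y ∈ Z) x₀ x) :
    D.rel S x₀ x := by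
  set F := nbhd D B (3 * r) s with hFdef
  set L : ℝ := k * (2 * (2 * r) + r) with hL
  have hL0 : 0 ≤ L := by positivity
  have hZF : ∀ x ∈ Z, x ∉ F := fun x hx hxF => by
    obtain ⟨-, z, hz, hzx⟩ := hxF
    exact hZE x hx z hz (hzx.mono (by linarith))
  have hcover : ∀ x ∈ Z, x ∈ stageSet B F s ∨
      ∃ v ∈ hanging B par F s, x ∈ branch B v ∧ x ∈ nbhd D B (2 * r) v := fun x hx => by
    rcases branch_cover (F := F) hT (hZs x hx) with h | h | ⟨v, hv, hxv⟩
    · exact absurd h (hZF x hx)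
    · exact .inl h
    · exact .inr ⟨v, hv, hxv, hZv x hx v hv hxv⟩
  have hsub : adh B s ⊆ F := adh_subset_nbhd (by positivity)
  -- a point together with a nearby point of the stage of the same colour
  let Good : V → V → Prop := fun x y => y ∈ stageSet B F s ∧ cY y = c x ∧ Reach D B r y x
  have good_self : ∀ x ∈ stageSet B F s, Good x x := fun x hx =>
    ⟨hx, (hcY x hx).symm, .refl x hr.le⟩
  have good_proj : ∀ v ∈ hanging B par F s, ∀ x ∈ nbhd D B r v, ∃ y ∈ adh B v, Good x y :=
    fun v hv x hx => by
      obtain ⟨z, hz, h1, h2⟩ := hproj v hv x hx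
      exact ⟨z, hz, mem_stageSet_of_mem_adh hB hv hz, h2.symm, h1⟩
  have link : ∀ {x x1 y y1}, Good x y → Good x1 y1 → Reach D B r x x1 → x1 ∈ Z →
      Reach D (stageBag B F s) (3 * r) y y1 := fun {x x1 y y1} h h1 hxx1 hx1 => by
    have hyy1 : Reach D B (3 * r) y y1 := ((h.2.2.trans hxx1).trans h1.2.2.symm).mono (by linarith)
    refine (hyy1.stage_or_through hT hB hsub h.1 h1.1).resolve_right ?_
    -- Adding `3r` from `z` to `f`, `3r` from `f` to `y1` and `r` from `y1` to `x1` gives the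
    -- excluded `7r`.
    rintro ⟨f, ⟨-, z, hz, hzf⟩, -, hf⟩
    exact hZE x1 hx1 z hz (((hzf.trans hf).trans h1.2.2).mono (by linarith))
  let Core : τ → V → V → Prop := fun v x y =>
    Mono D B r s c x y ∧ x ∈ nbhd D B (2 * r) v ∧ y ∈ nbhd D B (2 * r) v
  have core_bound : ∀ v {x y}, x ∈ nbhd D B (2 * r) v → ReflTransGen (Core v) x y → D.rel L x y :=
    fun v x y hx h => rel_of_chain_nbhd hr (hk v) hx h
  -- the point `y` of the stage stands for the last visit of a chain through `x` to the stage
  let Anchor : V → V → Prop := fun x y => y ∈ stageSet B F s ∧ cY y = c x ∧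
    (x = y ∨ ∃ v ∈ hanging B par F s, y ∈ adh B v ∧ ∃ w ∈ nbhd D B (2 * r) v,
      Reach D B r y w ∧ ReflTransGen (Core v) w x ∧ x ∈ nbhd D B (2 * r) v)
  let RY : V → V → Prop := fun x y => cY x = cY y ∧ Reach D (stageBag B F s) (L + 3 * r) x y
  -- The last condition says that a hanging branch is entered from outside or from its adhesion set,
  -- so `x1` is within `r` of that set.
  have new_good : ∀ {x x1}, x1 ∈ Z → Reach D B r x x1 →
      (∀ v ∈ hanging B par F s, x ∈ branch B v → x1 ∈ branch B v → x ∈ adh B v) →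
      ∃ y, Good x1 y ∧ Anchor x1 y := fun {x x1} hx1 hxx1 hv => by
    rcases hcover x1 hx1 with h | ⟨v, hvH, hx1v, hx1c⟩
    · exact ⟨x1, good_self x1 h, h, (hcY x1 h).symm, .inl rfl⟩
    · have : x1 ∈ nbhd D B r v := by
        by_cases hxv : x ∈ branch B v
        · exact ⟨hx1v, x, hv v hvH hxv hx1v, hxx1⟩
        · exact mem_nbhd_of_reach_of_notMem hxx1.symm hx1v hxv
      obtain ⟨y, hya, hy⟩ := good_proj v hvH x1 this
      exact ⟨y, hy, hy.1, hy.2.1, .inr ⟨v, hvH, hya, x1, hx1c, hy.2.2, .refl, hx1c⟩⟩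
  have good_step : ∀ {x x1 y}, Good x y → Mono D B r s c x x1 → x1 ∈ Z →
      (∀ v ∈ hanging B par F s, x ∈ branch B v → x1 ∈ branch B v → x ∈ adh B v) →
      ∃ y1, RY y y1 ∧ Anchor x1 y1 := fun {x x1 y} hy hxx1 hx1 hv => by
    obtain ⟨y1, hy1, hanc⟩ := new_good hx1 hxx1.2.2.2 hv
    refine ⟨y1, ⟨?_, (link hy hy1 hxx1.2.2.2 hx1).mono (by linarith)⟩, hanc⟩
    rw [hy.2.1, hy1.2.1, hxx1.2.2.1]
  -- a step that leaves a branch starts at a point with a companion in the adhesion set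
  have leave : ∀ {x x1 v}, v ∈ hanging B par F s → x ∈ nbhd D B (2 * r) v →
      Mono D B r s c x x1 → x1 ∈ Z → x1 ∉ nbhd D B (2 * r) v →
      ∃ y ∈ adh B v, Good x y ∧
        ∀ v ∈ hanging B par F s, x ∈ branch B v → x1 ∈ branch B v → x ∈ adh B v :=
    fun {x x1 v} hvH hx hxx1 hx1 hx1v => by
    have hx1b : x1 ∉ branch B v := fun h => hx1v (hZv x1 hx1 v hvH h)
    obtain ⟨y, hya, hy⟩ := good_proj v hvH x (mem_nbhd_of_reach_of_notMem hxx1.2.2.2 hx.1 hx1b)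
    refine ⟨y, hya, hy, fun v' hv' hxv' hx1v' => ?_⟩
    exact mem_adh_of_mem_branch hT hv' hvH (fun e => hx1b (e ▸ hx1v')) hxv' hx.1
  -- Invariant along the chain: either it has not left the neighbourhood of the hanging adhesion set
  -- where it began, or it is shadowed by an `RY`-chain ending at the current anchor.
  have key : (∃ v ∈ hanging B par F s, x₀ ∈ nbhd D B (2 * r) v ∧ x ∈ nbhd D B (2 * r) v ∧
      ReflTransGen (Core v) x₀ x) ∨
      ∃ y y', D.rel (L + r) x₀ y ∧ ReflTransGen RY y y' ∧ Anchor x y' := by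
    induction h with
    | refl =>
      rcases hcover x₀ hx₀ with h | ⟨v, hvH, -, hc⟩
      · exact .inr ⟨x₀, x₀, D.refl _ (by linarith), .refl, h, (hcY _ h).symm, .inl rfl⟩
      · exact .inl ⟨v, hvH, hc, hc, .refl⟩
    | @tail x x1 _ hstep ih =>
      obtain ⟨hxx1, -, hx1⟩ := hstep
      rcases ih with ⟨v, hvH, h0, hx, hch⟩ | ⟨y, y', hd, hyy', hyF, hyc, rfl | hcore⟩
      · by_cases hx1v : x1 ∈ nbhd D B (2 * r) v
        · exact .inl ⟨v, hvH, h0, hx1v, hch.tail ⟨hxx1, hx, hx1v⟩⟩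
        · obtain ⟨y, -, hy, hv⟩ := leave hvH hx hxx1 hx1 hx1v
          obtain ⟨y1, h1, h2⟩ := good_step hy hxx1 hx1 hv
          exact .inr ⟨y, y1, D.trans (core_bound v h0 hch) (D.symm hy.2.2.rel), .single h1, h2⟩
      · obtain ⟨y1, h1, h2⟩ := good_step (good_self x hyF) hxx1 hx1
          fun v hv hxv _ => mem_adh_of_mem_stageSet hv hyF hxv
        exact .inr ⟨y, y1, hd, hyy'.tail h1, h2⟩
      · obtain ⟨v, hvH, hya, w, hw, hyw, hwx, hx⟩ := hcore
        by_cases hx1v : x1 ∈ nbhd D B (2 * r) v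
        · exact .inr ⟨y, y', hd, hyy', hyF, hyc.trans hxx1.2.2.1,
            .inr ⟨v, hvH, hya, w, hw, hyw, hwx.tail ⟨hxx1, hx, hx1v⟩, hx1v⟩⟩
        · obtain ⟨y2, hy2a, hy2, hv⟩ := leave hvH hx hxx1 hx1 hx1v
          obtain ⟨y1, h1, h2⟩ := good_step hy2 hxx1 hx1 hv
          -- The completed excursion becomes one step inside the bag of `par v`: `r` to enter the
          -- core, `L` within it, `r` to return.
          have hy'y2 : RY y' y2 := by
            refine ⟨hyc.trans hy2.2.1.symm, ?_⟩
            refine .of_mem (mem_stageBag_of_mem_adh hB hvH hya)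
              (mem_stageBag_of_mem_adh hB hvH hy2a) (D.mono ?_ (D.trans (D.trans hyw.rel
                (core_bound v hw hwx)) hy2.2.2.symm.rel))
            linarith
          exact .inr ⟨y, y1, hd, (hyy'.tail hy'y2).tail h1, h2⟩
  rcases key with ⟨v, -, h0, -, hch⟩ | ⟨y, y', hd, hyy', -, -, rfl | ⟨v, -, -, w, hw, hyw, hwx, -⟩⟩
  · exact D.mono (by linarith) (core_bound v h0 hch)
  · exact D.mono (by linarith) (D.trans hd (hY _ _ hyy'))
  · exact D.mono (by linarith)
      (D.trans (D.trans hd (hY _ _ hyy')) (D.trans hyw.rel (core_bound v hw hwx)))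

/-- The inductive step of the construction: colourings of the stage at `s` and of the branches
hanging from it combine to a colouring of the branch at `s`. -/
theorem exists_isExtension_step [Finite V] [Finite τ] (hT : IsRooted root par)
    (hB : IsRootedDecomposition par B) {m : ℕ} {a b : Fin m} (hab : a ≠ b) {r : ℝ} (hr : 0 < r)
    {k : ℕ} (hk : ∀ w, (adh B w).ncard ≤ k) (s : τ) {E K : ℝ} (hE : 0 ≤ E)
    (hY : Colourable D (stageBag B (nbhd D B (3 * r) s) s) m
      (k * (2 * (2 * r) + r) + 3 * r) E)
    (hK : (k + 1) * (2 * (E + 2 * (k * (2 * (2 * r) + r) + r) + 8 * r) + r) ≤ K)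
    (hv : ∀ v, s < v → ∀ g : V → Fin m, ∃ c, IsExtension D B r K v g c) (g : V → Fin m) :
    ∃ c, IsExtension D B r K s g c := by
  obtain ⟨cY, hcY⟩ := hY
  have hcv : ∀ v, ∃ c, s < v → IsExtension D B r K v cY c := fun v => by
    by_cases h : s < v
    · exact (hv v h cY).imp fun _ h _ => h
    · exact ⟨cY, fun h' => absurd h' h⟩
  choose cv hcv using hcv
  obtain ⟨c, h1, h2, h3, h4, h5, h6⟩ := exists_assembled_colouring (D := D) hT hB a b hr s g cY cv
    fun v hv x hx => (hcv v hv.1).eq_adh x hx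
  set F := nbhd D B (3 * r) s with hF
  set S : ℝ := E + 2 * (k * (2 * (2 * r) + r) + r) with hS
  have hk0 : (0 : ℝ) ≤ k := k.cast_nonneg
  have hkr : 0 ≤ k * (2 * (2 * r) + r) := by positivity
  have hS0 : 0 ≤ S := by positivity
  -- The factor `k + 1` instead of `k` in `hK` gives this even for `k = 0`.
  have hSK : S ≤ K := by nlinarith
  have hLK : k * (2 * (2 * r) + r) ≤ K := by nlinarith
  have hEK : k * (2 * (S + 8 * r) + r) ≤ K := by nlinarith
  -- From within `r` one step stays within `2r`; a crossing from the next shell would have to change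
  -- colour from `a` to `b`.
  have closed : ∀ x y, x ∈ nbhd D B (2 * r) s → Mono D B r s c x y → y ∈ nbhd D B (2 * r) s := by
    intro x y hx hxy
    by_contra hy
    have hcy : c y = b := h4 y (mem_nbhd_of_reach hx hxy.2.1 hxy.2.2.2 (by linarith)) hy
    by_cases hxr : x ∈ nbhd D B r s
    · exact hy (mem_nbhd_of_reach hxr hxy.2.1 hxy.2.2.2 (by linarith))
    · exact hab ((h3 x hx hxr).symm.trans (hxy.2.2.1.trans hcy))
  refine ⟨c, h1, h2, closed, fun x₀ y₀ hch => ?_⟩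
  by_cases hs : x₀ ∈ nbhd D B (2 * r) s
  · exact D.mono hLK (rel_of_chain_nbhd hr (hk s) hs (chain_restrict closed hs hch).1)
  -- Leaving the branch requires being within `r` of its adhesion set; entering the
  -- `2r`-neighbourhood, reversed, would violate `closed` for `cv v`.
  have closedV : ∀ v ∈ hanging B par F s, ∀ x y, x ∈ branch B v ∧ x ∉ nbhd D B (2 * r) v →
      Mono D B r s c x y → y ∈ branch B v ∧ y ∉ nbhd D B (2 * r) v := by
    rintro v hvH x y ⟨hx, hx'⟩ hxy
    have hy : y ∈ branch B v := by
      by_contra hy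
      exact hx' (nbhd_mono (by linarith) (mem_nbhd_of_reach_of_notMem hxy.2.2.2 hx hy))
    refine ⟨hy, fun hy' => hx' ((hcv v hvH.1).closed y x hy' ⟨hy, hx, ?_, hxy.2.2.2.symm⟩)⟩
    rw [← h6 v hvH x hx, ← h6 v hvH y hy, hxy.2.2.1]
  by_cases hV : ∃ v ∈ hanging B par F s, x₀ ∈ branch B v ∧ x₀ ∉ nbhd D B (2 * r) v
  · obtain ⟨v, hvH, hx⟩ := hV
    refine (hcv v hvH.1).bounded _ _ (ReflTransGen.mono ?_ _ _
      (chain_restrict (closedV v hvH) hx hch).1)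
    rintro x y ⟨hxy, hx, hy⟩
    refine ⟨hx.1, hy.1, ?_, hxy.2.2.2⟩
    rw [← h6 v hvH x hx.1, ← h6 v hvH y hy.1, hxy.2.2.1]
  -- the remaining points: outside the neighbourhoods, or in the neighbourhood of a hanging branch
  let P : V → Prop := fun x => x ∉ nbhd D B (2 * r) s ∧
    ∀ v ∈ hanging B par F s, x ∈ branch B v → x ∈ nbhd D B (2 * r) v
  have closedP : ∀ x y, P x → Mono D B r s c x y → P y := by
    intro x y hx hxy
    refine ⟨fun hy => hx.1 (closed y x hy hxy.symm), fun v hvH hyv => ?_⟩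
    by_contra hy
    obtain ⟨h, h'⟩ := closedV v hvH y x ⟨hyv, hy⟩ hxy.symm
    exact h' (hx.2 v hvH h)
  have hP₀ : P x₀ := ⟨hs, by
    push Not at hV
    exact hV⟩
  rcases hch.cases_head with rfl | ⟨x₁, hx₁, -⟩
  · exact D.refl _ (hS0.trans hSK)
  have hx₀s : x₀ ∈ branch B s := hx₁.1
  clear hx₁ x₁
  -- Only here can rerouting through the stage fail.
  let T : Set V := {x | ∃ z ∈ adh B s, Reach D B (7 * r) z x}
  let Q : V → Prop := fun x => P x ∧ x ∈ branch B s
  have closedQ : ∀ x y, Q x → Mono D B r s c x y → Q y := fun x y hx hxy =>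
    ⟨closedP x y hx.1 hxy, hxy.2.1⟩
  let Z : Set V := {x | Q x ∧ x ∉ T}
  have avoid : ∀ {x y}, x ∈ Z →
      ReflTransGen (fun x y => (Mono D B r s c x y ∧ Q x ∧ Q y) ∧ x ∉ T ∧ y ∉ T) x y →
      D.rel S x y := by
    intro x y hx h
    refine rel_of_chain_stage hT hB hr hk s (c := c) (cY := cY) (Z := Z) hcY hE le_rfl h5
      (fun v hvH x hx => ?_) (fun x hx => hx.1.2) (fun x hx v hvH hxv => hx.1.1.2 v hvH hxv)
      (fun x hx z hz hzx => hx.2 ⟨z, hz, hzx⟩) hx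
      (ReflTransGen.mono (fun x y h => ⟨h.1.1, ⟨h.1.2.1, h.2.1⟩, h.1.2.2, h.2.2⟩) _ _ h)
    obtain ⟨z, hz, hzx, hc⟩ := (hcv v hvH.1).exists_proj x hx
    exact ⟨z, hz, hzx, (h6 v hvH x hx.1).trans hc⟩
  have hchQ := (chain_restrict closedQ ⟨hP₀, hx₀s⟩ hch).1
  let R : V → V → Prop := fun x y => Mono D B r s c x y ∧ Q x ∧ Q y
  have hRsymm : Std.Symm R := ⟨fun x y h => ⟨h.1.symm, h.2.2, h.2.1⟩⟩
  let J : V → Prop := fun x => ReflTransGen R x₀ x ∧ Q x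
  have closedJ : ∀ x y, J x → R x y → J y := fun x y hx hxy => ⟨hx.1.tail hxy, hxy.2.2⟩
  have hJ₀ : J x₀ := ⟨.refl, hP₀, hx₀s⟩
  have hchJ := (chain_restrict closedJ hJ₀ hchQ).1
  by_cases hhit : ∃ w ∈ T, ReflTransGen R x₀ w
  · obtain ⟨w, hwT, hw⟩ := hhit
    -- Follow the chain from `x` to its first hit of `T`: `S` before it, `r` for the step, `7r` from
    -- there to the adhesion set.
    have near : ∀ x, J x → ∃ z ∈ adh B s, D.rel (S + 8 * r) z x := by
      rintro x ⟨hx, hxQ⟩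
      by_cases hxT : x ∈ T
      · obtain ⟨z, hz, hzx⟩ := hxT
        exact ⟨z, hz, D.mono (by linarith) hzx.rel⟩
      · have hxw : ReflTransGen R x w := (ReflTransGen.stdSymm.symm _ _ hx).trans hw
        obtain ⟨u, u', hxu, huu', z, hz, hzu⟩ := (chain_first_hit T hxw hwT).resolve_left hxT
        exact ⟨z, hz, D.mono (by linarith) (D.symm (D.trans (D.trans (avoid ⟨hxQ, hxT⟩ hxu)
          huu'.1.2.2.2.rel) (D.symm hzu.rel)))⟩
    exact D.mono hEK (rel_of_chain_near D (R := R) hr.le (by positivity)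
      (fun _ _ h => h.1.2.2.2.rel) (Set.toFinite _) (hk s) (near _ hJ₀)
      (ReflTransGen.mono (fun x y h => ⟨h.1, near x h.2.1, near y h.2.2⟩) _ _ hchJ))
  · push Not at hhit
    refine D.mono hSK (avoid ⟨⟨hP₀, hx₀s⟩, fun h => hhit _ h .refl⟩
      (ReflTransGen.mono (fun x y h => ⟨h.1, ?_, ?_⟩) _ _ hchJ))
    · exact fun hx => hhit _ hx h.2.1.1
    · exact fun hy => hhit _ hy h.2.2.1

end

end TreeColouring

namespace TreeColouring

open Relation

/-! ### Induction over the tree and on the adhesion -/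

section

variable {V : Type u} {τ : Type v} [PartialOrder τ] {D : ScaleRel V} {B : τ → Set V} {root : τ}
  {par : τ → τ}

theorem exists_isExtension [Finite V] [Finite τ] (hT : IsRooted root par)
    (hB : IsRootedDecomposition par B) {m : ℕ} {a b : Fin m} (hab : a ≠ b) {r : ℝ} (hr : 0 < r)
    {k : ℕ} (hk : ∀ w, (adh B w).ncard ≤ k) {E K : ℝ} (hE : 0 ≤ E)
    (hY : ∀ s, Colourable D (stageBag B (nbhd D B (3 * r) s) s) m
      (k * (2 * (2 * r) + r) + 3 * r) E)
    (hK : (k + 1) * (2 * (E + 2 * (k * (2 * (2 * r) + r) + r) + 8 * r) + r) ≤ K) (s : τ) :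
    ∀ g : V → Fin m, ∃ c, IsExtension D B r K s g c := by
  induction s using (Finite.wellFounded_of_trans_of_irrefl (fun x y : τ => y < x)).induction with
  | _ s ih => exact exists_isExtension_step hT hB hab hr hk s hE (hY s) hK ih

/-- The branch at the root contains every bag and its adhesion set is empty, so the prescribed
colouring is immaterial. Points in no bag carry only trivial chains. -/
theorem colourable_of_stages [Finite V] [Finite τ] (hT : IsRooted root par)
    (hB : IsRootedDecomposition par B) {m : ℕ} {a b : Fin m} (hab : a ≠ b) {r : ℝ} (hr : 0 < r)
    {k : ℕ} (hk : ∀ w, (adh B w).ncard ≤ k) {E K : ℝ} (hE : 0 ≤ E)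
    (hY : ∀ s, Colourable D (stageBag B (nbhd D B (3 * r) s) s) m
      (k * (2 * (2 * r) + r) + 3 * r) E)
    (hK : (k + 1) * (2 * (E + 2 * (k * (2 * (2 * r) + r) + r) + 8 * r) + r) ≤ K) :
    Colourable D B m r K := by
  obtain ⟨c, hc⟩ := exists_isExtension hT hB hab hr hk hE hY hK root fun _ => a
  have hK0 : 0 ≤ K := le_trans (by positivity) hK
  refine ⟨c, fun x y hxy => ?_⟩
  have : x = y ∨ ReflTransGen (Mono D B r root c) x y := by
    induction hxy with
    | refl => exact .inl rfl
    | @tail y z _ h ih =>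
      by_cases hyz : y = z
      · exact hyz ▸ ih
      have hy := h.2.eq_or_mem.resolve_left hyz
      have hz := h.2.symm.eq_or_mem.resolve_left (Ne.symm hyz)
      have hstep : Mono D B r root c y z :=
        ⟨hy.imp fun t ht => ⟨hT.root_le t, ht⟩, hz.imp fun t ht => ⟨hT.root_le t, ht⟩, h⟩
      rcases ih with rfl | ih
      · exact .inr (.single hstep)
      · exact .inr (ih.tail hstep)
  rcases this with rfl | h
  · exact D.refl x hK0
  · exact hc.bounded x y h

/-- If all adhesion sets are empty, then the stages are single bags. -/
theorem colourable_stageBag_of_adh_eq_empty (hadh : ∀ w, adh B w = ∅) {m : ℕ} {C : ℝ}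
    (hbag : BagsColourable D B m C) {r : ℝ} (hr : 0 < r) (F : Set V) (s : τ) :
    Colourable D (stageBag B F s) m r (C * r) := by
  have hst : ∀ t x, x ∈ stageBag B F s t → x ∈ B s := by
    intro t x hx
    rcases hx.2.2.1.eq_or_lt with rfl | h
    · exact hx.1
    · obtain ⟨y, hy, -⟩ := hx.2.2.2 t h le_rfl
      simp [hadh t] at hy
  obtain ⟨c, hc⟩ := hbag s r hr
  refine ⟨c, fun x y hxy => hc x y ?_⟩
  induction hxy with
  | refl => exact .refl
  | @tail y z _ h ih =>
    by_cases hyz : y = z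
    · exact hyz ▸ ih
    obtain ⟨t, ht⟩ := h.2.eq_or_mem.resolve_left hyz
    obtain ⟨t', ht'⟩ := h.2.symm.eq_or_mem.resolve_left (Ne.symm hyz)
    exact ih.tail ⟨hst t y ht, hst t' z ht', h.1, h.2.rel⟩

end

/-- A rooted tree-decomposition of bounded adhesion of a finite space has colourings with linear
control if its bags do, and if there are at least two colours. -/
theorem exists_colourable {m : ℕ} {a b : Fin m} (hab : a ≠ b) {C : ℝ} (hC : 0 ≤ C) (k : ℕ) :
    ∃ K : ℝ, 0 ≤ K ∧ ∀ {V : Type u} {τ : Type v} [Finite V] [Finite τ] [PartialOrder τ]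
      {root : τ} {par : τ → τ} {D : ScaleRel V} {B : τ → Set V}, IsRooted root par →
      IsRootedDecomposition par B → (∀ w, (adh B w).ncard ≤ k) → BagsColourable D B m C →
      ∀ r : ℝ, 0 < r → Colourable D B m r (K * r) := by
  -- Passing from stages to the whole is the same for every `k`; only the source of the stage
  -- colourings differs, single bags for `k = 0` and smaller adhesion otherwise.
  have step : ∀ (k : ℕ) (K : ℝ), 0 ≤ K → (∀ {V : Type u} {τ : Type v} [Finite V] [Finite τ]
      [PartialOrder τ] {root : τ} {par : τ → τ} {D : ScaleRel V} {B : τ → Set V},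
      IsRooted root par → IsRootedDecomposition par B → (∀ w, (adh B w).ncard ≤ k) →
      BagsColourable D B m C → ∀ r : ℝ, 0 < r → ∀ (F : Set V) (s : τ),
      Colourable D (stageBag B F s) m r (K * r)) →
      ∃ K : ℝ, 0 ≤ K ∧ ∀ {V : Type u} {τ : Type v} [Finite V] [Finite τ] [PartialOrder τ]
        {root : τ} {par : τ → τ} {D : ScaleRel V} {B : τ → Set V}, IsRooted root par →
        IsRootedDecomposition par B → (∀ w, (adh B w).ncard ≤ k) → BagsColourable D B m C →
        ∀ r : ℝ, 0 < r → Colourable D B m r (K * r) := by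
    intro k K hK h
    -- The stages are coloured at scale `(5k + 3)r`, so `E = K(5k + 3)r`; the rest is `hK` divided
    -- by `r`.
    refine ⟨(k + 1) * (2 * (K * (5 * k + 3) + 2 * (5 * k + 1) + 8) + 1), by positivity, ?_⟩
    intro V τ _ _ _ root par D B hT hB hk hbag r hr
    have hr' : 0 < k * (2 * (2 * r) + r) + 3 * r := by positivity
    refine colourable_of_stages hT hB hab hr hk (mul_nonneg hK hr'.le)
      (fun s => h hT hB hk hbag _ hr' _ s) (le_of_eq ?_)
    ring
  induction k with
  | zero =>
    refine step 0 C hC fun {V τ} _ _ _ root par D B hT hB hk hbag r hr F s => ?_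
    refine colourable_stageBag_of_adh_eq_empty (fun w => ?_) hbag hr F s
    exact (Set.ncard_eq_zero (Set.toFinite _)).1 (Nat.le_zero.1 (hk w))
  | succ k ih =>
    obtain ⟨K, hK, h⟩ := ih
    refine step (k + 1) K hK fun {V τ} _ _ _ root par D B hT hB hk hbag r hr F s => ?_
    exact h hT (stageBag_isRootedDecomposition hT hB).1 (ncard_adh_stageBag_le hT hB hk)
      (hbag.mono stageBag_subset) r hr

/-! ### Rooting a tree and its decomposition -/

theorem exists_isRooted {T : SimpleGraph τ} (hT : T.IsTree) (root : τ) :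
    ∃ (_ : PartialOrder τ) (par : τ → τ), IsRooted root par ∧
      (∀ a b, T.Adj a b → a ≠ root ∧ par a = b ∨ b ≠ root ∧ par b = a) ∧
      ∀ t, t ≠ root → T.Adj t (par t) := by
  choose P hP hPu using fun t => hT.existsUnique_path root t
  let par : τ → τ := fun t => (P t).penultimate
  let d : τ → ℕ := fun t => (P t).length
  have hd0 : ∀ t, d t = 0 → t = root := fun t h =>
    (SimpleGraph.Walk.eq_of_length_eq_zero h).symm
  -- Truncated subtraction is right at the root, which is its own parent.
  have hd : ∀ t, d (par t) = d t - 1 := fun t => by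
    have : (P t).dropLast = P (par t) := hPu _ _ (hP t).dropLast
    simp only [d, ← this, SimpleGraph.Walk.length_dropLast]
  have hit : ∀ i t, d (par^[i] t) = d t - i := fun i => by
    induction i with
    | zero => simp
    | succ i ih => intro t; rw [Function.iterate_succ_apply, ih, hd]; omega
  let po : PartialOrder τ :=
    { le := fun s t => ∃ i, par^[i] t = s
      le_refl := fun t => ⟨0, rfl⟩
      le_trans := by
        rintro _ _ t ⟨i, rfl⟩ ⟨j, rfl⟩
        exact ⟨i + j, Function.iterate_add_apply _ _ _ _⟩
      le_antisymm := by
        rintro s t ⟨i, hi⟩ ⟨j, hj⟩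
        have h1 := hit i t
        have h2 := hit j s
        rw [hi] at h1
        rw [hj] at h2
        rcases Nat.eq_zero_or_pos i with rfl | hi0
        · exact hi.symm
        · rw [hd0 s (by omega), hd0 t (by omega)] }
  refine ⟨po, par, ⟨fun t => ⟨d t, hd0 _ (by rw [hit]; omega)⟩, fun t ht => ?_, fun s t hst => ?_,
    ?_⟩, fun a b hab => ?_, fun t ht => ?_⟩
  · refine lt_of_le_of_ne ⟨1, rfl⟩ fun e => ht (hd0 t ?_)
    have := hd t
    rw [e] at this
    omega
  · obtain ⟨i, hi⟩ := hst.le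
    cases i with
    | zero => exact absurd hi hst.ne'
    | succ i => exact ⟨i, hi⟩
  · rintro s s' t ⟨i, rfl⟩ ⟨j, rfl⟩
    rcases le_total i j with h | h
    · exact .inr ⟨j - i, by rw [← Function.iterate_add_apply, Nat.sub_add_cancel h]⟩
    · exact .inl ⟨i - j, by rw [← Function.iterate_add_apply, Nat.sub_add_cancel h]⟩
  · have hpar : ∀ {a b}, T.Adj a b → par a = b → a ≠ root ∧ par a = b := by
      rintro a b hab rfl
      refine ⟨?_, rfl⟩
      rintro rfl
      have h0 : d a = 0 := by
        simp only [d, ← hPu a .nil SimpleGraph.Walk.IsPath.nil, SimpleGraph.Walk.length_nil]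
      exact hab.ne (hd0 (par a) (by rw [hd, h0])).symm
    by_cases hb : b ∈ (P a).support
    · exact .inl (hpar hab (hT.isAcyclic.eq_penultimate_of_adj_end (hP a) hab hb).symm)
    · exact .inr (hpar hab.symm (hT.isAcyclic.eq_penultimate_of_adj_end (hP b) hab.symm
        (hT.isAcyclic.mem_support_of_ne_mem_support_of_adj_of_isPath (hP b) (hP a) hab.symm
          hb)).symm)
  · exact (SimpleGraph.Walk.adj_penultimate
      (fun h => ht (SimpleGraph.Walk.Nil.eq h).symm)).symm

/-- The unique tree edge leaving the descendants of `s` joins `s` to its parent. -/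
theorem IsRooted.eq_of_leaving [PartialOrder τ] {root : τ} {par : τ → τ} (h : IsRooted root par)
    {s a b : τ} (hab : a ≠ root ∧ par a = b ∨ b ≠ root ∧ par b = a) (ha : s ≤ a) (hb : ¬ s ≤ b) : a = s ∧ b = par s := by
  rcases hab with ⟨-, rfl⟩ | ⟨hr, rfl⟩
  · have : s = a := by
      by_contra hne
      exact hb (h.le_par _ _ (lt_of_le_of_ne ha hne))
    subst this
    exact ⟨rfl, rfl⟩
  · exact absurd (ha.trans (h.par_lt b hr).le) hb

theorem exists_leaving_edge {α : Type*} {G : SimpleGraph α} (P : α → Prop) {a b : α}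
    (p : G.Walk a b) (ha : P a) (hb : ¬ P b) : ∃ x y, G.Adj x y ∧ P x ∧ ¬ P y := by
  induction p with
  | nil => exact absurd ha hb
  | @cons x y z h p ih =>
    by_cases hy : P y
    · exact ih hy hb
    · exact ⟨x, y, h, ha, hy⟩

/-- A walk among the nodes whose bags contain `x` must cross the edge between `s` and `par s`, the
only one leaving the descendants of `s`. -/
theorem isRootedDecomposition_of_isTreeDecomposition [PartialOrder τ] {root : τ} {par : τ → τ}
    {G : SimpleGraph V} {T : SimpleGraph τ} {B : τ → Set V} (hT : IsRooted root par)
    (hadj : ∀ a b, T.Adj a b → a ≠ root ∧ par a = b ∨ b ≠ root ∧ par b = a)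
    (hB : WeightedGraph.IsTreeDecomposition G T B) : IsRootedDecomposition par B := by
  intro s t t' x hst hst' hx hx'
  obtain ⟨p⟩ := (hB.connected x).preconnected ⟨t, hx⟩ ⟨t', hx'⟩
  obtain ⟨a, b, hab, ha, hb⟩ := exists_leaving_edge (fun a : {t | x ∈ B t} => s ≤ a.1) p hst hst'
  obtain ⟨h1, h2⟩ := hT.eq_of_leaving (hadj _ _ hab) ha hb
  exact ⟨h1 ▸ a.2, h2 ▸ b.2⟩

end TreeColouring

/-! ### Distances and colourings in weighted graphs -/

namespace WeightedGraph

open TreeColouring Relation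

variable (G : WeightedGraph.{u})

theorem dist_le_walkLength {x y : G.V} (p : G.graph.Walk x y) : G.dist x y ≤ G.walkLength p := by
  classical
  have key : ∀ {x y : G.V} (p : G.graph.Walk x y), G.walkLength p.bypass ≤ G.walkLength p := by
    intro x y p
    induction p with
    | nil => simp [SimpleGraph.Walk.bypass]
    | @cons x y z h p ih =>
      simp only [SimpleGraph.Walk.bypass]
      split_ifs with hs
      · have h1 := G.walkLength_append (p.bypass.takeUntil x hs) (p.bypass.dropUntil x hs)
        rw [SimpleGraph.Walk.take_spec] at h1
        calc G.walkLength (p.bypass.dropUntil x hs) ≤ G.walkLength p.bypass := by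
              rw [h1]; exact le_add_self
          _ ≤ G.walkLength p := ih
          _ ≤ _ := by simp only [walkLength]; exact le_add_self
      · simp only [walkLength]
        gcongr
  exact (iInf_le _ p.toPath).trans (key p)

theorem dist_self (x : G.V) : G.dist x x = 0 :=
  le_antisymm ((G.dist_le_walkLength .nil).trans (by simp [walkLength])) bot_le

theorem dist_le_weight {x y : G.V} (h : G.graph.Adj x y) : G.dist x y ≤ G.weight h :=
  (G.dist_le_walkLength (.cons h .nil)).trans (by simp [walkLength])

/-- The distance is attained by a walk, if there is a walk. -/
theorem exists_walk_of_dist_ne_top {x y : G.V} (h : G.dist x y ≠ ⊤) :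
    ∃ p : G.graph.Walk x y, G.walkLength p = G.dist x y := by
  classical
  have := Fintype.ofFinite G.V
  have : Finite (G.graph.Path x y) := Finite.of_fintype _
  rcases isEmpty_or_nonempty (G.graph.Path x y) with h' | h'
  · exact absurd (by rw [dist, iInf_of_empty]) h
  · obtain ⟨p, hp⟩ := Finite.exists_min fun p : G.graph.Path x y => G.walkLength p.1
    exact ⟨p.1, le_antisymm (le_iInf hp) (iInf_le _ p)⟩

theorem dist_triangle (x y z : G.V) : G.dist x z ≤ G.dist x y + G.dist y z := by
  by_cases h : G.dist x y = ⊤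
  · simp [h]
  by_cases h' : G.dist y z = ⊤
  · simp [h']
  obtain ⟨p, hp⟩ := G.exists_walk_of_dist_ne_top h
  obtain ⟨q, hq⟩ := G.exists_walk_of_dist_ne_top h'
  rw [← hp, ← hq, ← walkLength_append]
  exact G.dist_le_walkLength _

/-- The relations "at distance at most `a`" of a weighted graph. -/
noncomputable def scaleRel : ScaleRel G.V where
  rel a x y := 0 ≤ a ∧ G.dist x y ≤ ENNReal.ofReal a
  nonneg h := h.1
  refl x h := ⟨h, by simp [G.dist_self x]⟩
  symm h := ⟨h.1, G.dist_comm _ _ ▸ h.2⟩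
  mono h h' := ⟨h'.1.trans h, h'.2.trans (ENNReal.ofReal_le_ofReal h)⟩
  trans h h' := ⟨add_nonneg h.1 h'.1, by
    rw [ENNReal.ofReal_add h.1 h'.1]
    exact (G.dist_triangle _ _ _).trans (add_le_add h.2 h'.2)⟩

/-- Every edge lies in a bag and its weight bounds the distance of its ends, so a walk is a chain of
no greater length. -/
theorem reach_of_walk {τ : Type v} {B : τ → Set G.V}
    (hB : ∀ x y, G.graph.Adj x y → ∃ t, x ∈ B t ∧ y ∈ B t) {x y : G.V} (p : G.graph.Walk x y) :
    ∀ {r : ℝ}, 0 ≤ r → G.walkLength p ≤ ENNReal.ofReal r → Reach G.scaleRel B r x y := by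
  induction p with
  | nil => exact fun hr _ => .refl _ hr
  | @cons x y z h p ih =>
    intro r hr hp
    simp only [walkLength] at hp
    have hne : G.weight h ≠ ⊤ := (lt_of_le_of_lt (le_self_add.trans hp) ENNReal.ofReal_lt_top).ne
    have hne' : G.walkLength p ≠ ⊤ := (lt_of_le_of_lt (le_add_self.trans hp) ENNReal.ofReal_lt_top).ne
    obtain ⟨t, hx, hy⟩ := hB x y h
    refine .step t hx hy ⟨ENNReal.toReal_nonneg, ?_⟩
      (ih ENNReal.toReal_nonneg (ENNReal.ofReal_toReal hne').ge)
      (a := (G.weight h).toReal) ?_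
    · rw [ENNReal.ofReal_toReal hne]
      exact G.dist_le_weight h
    · rw [← ENNReal.toReal_add hne hne']
      exact ENNReal.toReal_le_of_le_ofReal hr hp

theorem reach_of_rel {τ : Type v} {B : τ → Set G.V}
    (hB : ∀ x y, G.graph.Adj x y → ∃ t, x ∈ B t ∧ y ∈ B t) {x y : G.V} {r : ℝ}
    (h : G.scaleRel.rel r x y) : Reach G.scaleRel B r x y := by
  obtain ⟨p, hp⟩ := G.exists_walk_of_dist_ne_top (h.2.trans_lt ENNReal.ofReal_lt_top).ne
  exact G.reach_of_walk hB p h.1 (hp.trans_le h.2)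

/-- A colouring bounds monochromatic chains. -/
theorem IsColouring.rel_of_chain {G : WeightedGraph.{u}} {m : ℕ} {r d : ℝ} {c : G.V → Fin m}
    (hc : G.IsColouring m r d c) (hd : 0 ≤ d) {x y : G.V}
    (h : ReflTransGen (fun x y => c x = c y ∧ G.dist x y ≤ ENNReal.ofReal r) x y) :
    G.scaleRel.rel d x y := by
  have hw : ∃ p : (G.power r).Walk x y, ∀ z ∈ p.support, c z = c x := by
    induction h with
    | refl => exact ⟨.nil, by simp⟩
    | @tail y z _ h ih =>
      obtain ⟨p, hp⟩ := ih
      by_cases hyz : y = z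
      · exact hyz ▸ ⟨p, hp⟩
      · have hadj : (G.power r).Adj y z := ⟨hyz, h.2⟩
        refine ⟨p.concat hadj, fun w hw => ?_⟩
        rw [SimpleGraph.Walk.support_concat, List.mem_append, List.mem_singleton] at hw
        rcases hw with hw | rfl
        · exact hp w hw
        · rw [← h.1, hp y p.end_mem_support]
  obtain ⟨p, hp⟩ := hw
  obtain ⟨M, hpM, hM⟩ := Finite.exists_le_maximal
    (p := fun N : (G.power r).Subgraph => N.Connected ∧ ∀ z ∈ N.verts, c z = c x)
    (a := p.toSubgraph) ⟨p.toSubgraph_connected, fun z hz => hp z (by simpa using hz)⟩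
  refine ⟨hd, le_trans ?_ (hc M ⟨c x, hM⟩)⟩
  have hx : x ∈ M.verts := hpM.1 (by simp)
  have hy : y ∈ M.verts := hpM.1 (by simp)
  exact le_iSup₂_of_le x hx (le_iSup₂_of_le (f := fun y _ => G.dist x y) y hy le_rfl)

/-- Bounds on monochromatic chains give a colouring. -/
theorem isColouring_of_chain {G : WeightedGraph.{u}} {m : ℕ} {r d : ℝ} {c : G.V → Fin m}
    (hc : ∀ x y, ReflTransGen (fun x y => c x = c y ∧ G.dist x y ≤ ENNReal.ofReal r) x y →
      G.scaleRel.rel d x y) : G.IsColouring m r d c := by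
  rintro M ⟨i, hM⟩
  refine iSup₂_le fun x hx => iSup₂_le fun y hy => (hc x y ?_).2
  obtain ⟨p⟩ := hM.prop.1.preconnected ⟨x, hx⟩ ⟨y, hy⟩
  have key : ∀ {a b : M.verts} (p : M.coe.Walk a b),
      ReflTransGen (fun x y => c x = c y ∧ G.dist x y ≤ ENNReal.ofReal r) a.1 b.1 := by
    intro a b p
    induction p with
    | nil => exact .refl
    | @cons a b _ h p ih =>
      exact ih.head ⟨(hM.prop.2 a a.2).trans (hM.prop.2 b b.2).symm, (M.adj_sub h).2⟩
  exact key p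

end WeightedGraph

/-! ### Weighted torsos -/

namespace WeightedGraph

open TreeColouring Relation

variable {τ : Type v} (G : WeightedGraph.{u}) (T : SimpleGraph τ) (B : τ → Set G.V) (t : τ)

theorem dist_le_dist_weightedTorso (x y : (G.weightedTorso T B t).V) :
    G.dist x.1 y.1 ≤ (G.weightedTorso T B t).dist x y := by
  have key : ∀ {x y : (G.weightedTorso T B t).V} (p : (G.weightedTorso T B t).graph.Walk x y),
      G.dist x.1 y.1 ≤ (G.weightedTorso T B t).walkLength p := by
    intro x y p
    induction p with
    | nil => exact (G.dist_self _).trans_le bot_le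
    | @cons x y z h p ih =>
      simp only [walkLength]
      exact (G.dist_triangle _ y.1 _).trans (add_le_add le_rfl ih)
  exact le_iInf fun p => key p.1

variable {G T B t}

theorem dist_weightedTorso_le_of_adj {x y : (G.weightedTorso T B t).V}
    (h : (G.weightedTorso T B t).graph.Adj x y) :
    (G.weightedTorso T B t).dist x y ≤ G.dist x.1 y.1 :=
  (G.weightedTorso T B t).dist_le_weight h

theorem dist_weightedTorso_le_of_mem {t' : τ} (htt' : T.Adj t t') {x y : G.V} (hx : x ∈ B t)
    (hy : y ∈ B t) (hx' : x ∈ B t') (hy' : y ∈ B t') :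
    (G.weightedTorso T B t).dist ⟨x, hx⟩ ⟨y, hy⟩ ≤ G.dist x y := by
  by_cases hxy : x = y
  · subst hxy
    exact ((G.weightedTorso T B t).dist_self _).trans_le bot_le
  · exact dist_weightedTorso_le_of_adj (x := ⟨x, hx⟩) (y := ⟨y, hy⟩)
      ⟨fun e => hxy (congrArg Subtype.val e), .inr ⟨t', htt', ⟨hx, hx'⟩, hy, hy'⟩⟩

theorem dist_weightedTorso_le_of_edge {x y : G.V} (h : G.graph.Adj x y) (hx : x ∈ B t)
    (hy : y ∈ B t) : (G.weightedTorso T B t).dist ⟨x, hx⟩ ⟨y, hy⟩ ≤ G.dist x y :=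
  dist_weightedTorso_le_of_adj (x := ⟨x, hx⟩) (y := ⟨y, hy⟩)
    ⟨fun e => h.ne (congrArg Subtype.val e), .inl h⟩

/-- The distance in a weighted torso is the distance in the whole graph. -/
theorem dist_weightedTorso_le [Finite τ] (hTB : IsTreeDecomposition G.graph T B)
    (x y : (G.weightedTorso T B t).V) :
    (G.weightedTorso T B t).dist x y ≤ G.dist x.1 y.1 := by
  obtain ⟨_, par, hT, hadj, hpar⟩ := exists_isRooted hTB.isTree t
  have hB := isRootedDecomposition_of_isTreeDecomposition hT hadj hTB
  obtain ⟨y, hy⟩ := y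
  -- Rooted at `t` and with `F = ∅`, the stage is `t` alone and the hanging branches are those at
  -- its neighbours.
  have hstage : ∀ u, u ∈ stage B ∅ t → u = t := by
    rintro u ⟨htu, hu⟩
    by_contra hne
    obtain ⟨z, -, h⟩ := hu u (lt_of_le_of_ne htu (Ne.symm hne)) le_rfl
    exact h
  have hchild : ∀ v ∈ hanging B par ∅ t, T.Adj t v ∧ ∀ x ∈ adh B v, x ∈ B t ∧ x ∈ B v := by
    intro v hv
    have hvt : par v = t := hstage _ hv.2.1
    refine ⟨hvt ▸ (hpar v hv.1.ne').symm, fun x hx => ?_⟩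
    have := adh_subset hB hx
    exact ⟨hvt ▸ this.2, this.1⟩
  have hadhv : ∀ v ∈ hanging B par ∅ t, ∀ x ∈ B t, x ∈ branch B v → x ∈ adh B v :=
    fun v hv x hxt hx => ⟨hx, t, fun h => (hv.1.trans_le h).false, hxt⟩
  have hcl : ∀ {x : G.V} {ℓ : ℝ≥0∞} (hx : x ∈ B t), (∃ v ∈ hanging B par ∅ t, x ∈ branch B v ∧
      ∃ z, ∃ hz : z ∈ B t, z ∈ B v ∧
        G.dist x z + (G.weightedTorso T B t).dist ⟨z, hz⟩ ⟨y, hy⟩ ≤ ℓ) →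
      (G.weightedTorso T B t).dist ⟨x, hx⟩ ⟨y, hy⟩ ≤ ℓ := by
    rintro x ℓ hx ⟨v, hv, hxv, z, hz, hzv, hle⟩
    refine le_trans ((G.weightedTorso T B t).dist_triangle _ ⟨z, hz⟩ _)
      (le_trans (add_le_add ?_ le_rfl) hle)
    exact dist_weightedTorso_le_of_mem (hchild v hv).1 hx hz
      ((hchild v hv).2 x (hadhv v hv x hx hxv)).2 hzv
  -- As in `Reach.stage_or_through`: inside a hanging branch, record the vertex `z` through which
  -- the walk returns to `B t`. Shortcuts between adhesion points are torso edges.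
  have key : ∀ {x y' : G.V} (p : G.graph.Walk x y'), y' = y →
      (∃ hx : x ∈ B t, (G.weightedTorso T B t).dist ⟨x, hx⟩ ⟨y, hy⟩ ≤ G.walkLength p) ∨
      (∃ v ∈ hanging B par ∅ t, x ∈ branch B v ∧ ∃ z, ∃ hz : z ∈ B t, z ∈ B v ∧
        G.dist x z + (G.weightedTorso T B t).dist ⟨z, hz⟩ ⟨y, hy⟩ ≤ G.walkLength p) := by
    intro x y' p hy'
    induction p with
    | nil =>
      subst hy'
      exact .inl ⟨hy, ((G.weightedTorso T B t).dist_self _).trans_le bot_le⟩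
    | @cons x x' _ h p ih =>
      obtain ⟨u, hxu, hx'u⟩ := hTB.edge_mem _ _ h
      have ih := ih hy'
      have hw := G.dist_le_weight h
      simp only [walkLength]
      by_cases hut : u = t
      · subst hut
        have ih' : (G.weightedTorso T B u).dist ⟨x', hx'u⟩ ⟨y, hy⟩ ≤ G.walkLength p := by
          rcases ih with ⟨_, ih⟩ | ih
          · exact ih
          · exact hcl hx'u ih
        refine .inl ⟨hxu, ((G.weightedTorso T B u).dist_triangle _ ⟨x', hx'u⟩ _).trans
          (add_le_add (le_trans ?_ hw) ih')⟩
        exact dist_weightedTorso_le_of_edge h hxu hx'u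
      · obtain ⟨v, hv, hvu⟩ := exists_hanging_le (B := B) hT (hT.root_le u)
          fun hu => hut (hstage u hu)
        refine .inr ⟨v, hv, ⟨u, hvu, hxu⟩, ?_⟩
        by_cases hx't : x' ∈ B t
        · have ih' : (G.weightedTorso T B t).dist ⟨x', hx't⟩ ⟨y, hy⟩ ≤ G.walkLength p := by
            rcases ih with ⟨_, ih⟩ | ih
            · exact ih
            · exact hcl hx't ih
          exact ⟨x', hx't, ((hchild v hv).2 x' (hadhv v hv x' hx't ⟨u, hvu, hx'u⟩)).2,
            add_le_add hw ih'⟩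
        · rcases ih with ⟨hx't', -⟩ | ⟨v', hv', hx'v', z, hz, hzv, hle⟩
          · exact absurd hx't' hx't
          have hvv' : v' = v := by
            by_contra hne
            exact hx't ((hchild v hv).2 x' (mem_adh_of_mem_branch hT hv hv' (Ne.symm hne)
              ⟨u, hvu, hx'u⟩ hx'v')).1
          subst hvv'
          refine ⟨z, hz, hzv, ?_⟩
          calc _ ≤ (G.dist x x' + G.dist x' z) + _ := add_le_add (G.dist_triangle _ _ _) le_rfl
            _ = G.dist x x' + (G.dist x' z + _) := add_assoc _ _ _
            _ ≤ _ := add_le_add hw hle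
  refine le_iInf fun p => ?_
  rcases key p.1 rfl with ⟨_, h⟩ | h
  · exact h
  · exact hcl x.2 h

/-- Torso distances equal those of the whole graph, so a torso colouring is one of the bag; colours
beyond `n + 1` are not needed on the bag. -/
theorem bagsColourable [Finite τ] (hTB : IsTreeDecomposition G.graph T B) {n N : ℕ} (hnN : n ≤ N)
    {f : Set.Ioi (0 : ℝ) → Set.Ioi (0 : ℝ)} {C : ℝ} (hf : ∀ r, (f r : ℝ) ≤ C * r)
    (h : ∀ t, IsControlFunction n f (G.weightedTorso T B t)) :
    BagsColourable G.scaleRel B (N + 1) C := by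
  classical
  intro t r hr
  obtain ⟨c, hc⟩ := h t ⟨r, hr⟩
  have hfr := hf ⟨r, hr⟩
  have hf0 : 0 < (f ⟨r, hr⟩ : ℝ) := (f ⟨r, hr⟩).2
  let g : G.V → Fin (N + 1) := fun x =>
    if hx : x ∈ B t then Fin.castLE (by omega) (c ⟨x, hx⟩) else 0
  have hg : ∀ x (hx : x ∈ B t), g x = Fin.castLE (by omega) (c ⟨x, hx⟩) := fun x hx => dif_pos hx
  refine ⟨g, fun x y hxy => ?_⟩
  have key : x = y ∨ ∃ (hx : x ∈ B t) (hy : y ∈ B t), ReflTransGen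
      (fun x y : (G.weightedTorso T B t).V => c x = c y ∧
        (G.weightedTorso T B t).dist x y ≤ ENNReal.ofReal r) ⟨x, hx⟩ ⟨y, hy⟩ := by
    induction hxy with
    | refl => exact .inl rfl
    | @tail y z _ hyz ih =>
      obtain ⟨hy, hz, hcyz, hd⟩ := hyz
      rw [hg y hy, hg z hz] at hcyz
      have hstep : c ⟨y, hy⟩ = c ⟨z, hz⟩ ∧
          (G.weightedTorso T B t).dist ⟨y, hy⟩ ⟨z, hz⟩ ≤ ENNReal.ofReal r :=
        ⟨Fin.castLE_injective _ hcyz, (dist_weightedTorso_le hTB _ _).trans hd.2⟩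
      rcases ih with rfl | ⟨hx, _, ih⟩
      · exact .inr ⟨hy, hz, .single hstep⟩
      · exact .inr ⟨hx, hz, ih.tail hstep⟩
  rcases key with rfl | ⟨hx, hy, hch⟩
  · exact G.scaleRel.refl _ (hf0.le.trans hfr)
  · have := hc.rel_of_chain hf0.le hch
    exact ⟨hf0.le.trans hfr, (dist_le_dist_weightedTorso G T B t _ _).trans
      (this.2.trans (ENNReal.ofReal_le_ofReal hfr))⟩

/-! ### Control functions for constructable graphs -/

theorem ncard_adh_le [PartialOrder τ] {root : τ} {par : τ → τ} (hT : IsRooted root par)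
    (hB : IsRootedDecomposition par B) (hpar : ∀ t, t ≠ root → T.Adj t (par t)) {k : ℕ}
    (hk : adhesion T B ≤ k) (s : τ) : (adh B s).ncard ≤ k := by
  by_cases hs : s = root
  · rw [hs, adh_root hT]
    simp
  · have h1 : (B s ∩ B (par s)).encard ≤ k :=
      le_trans (le_iSup₂_of_le (f := fun t t' => ⨆ _ : T.Adj t t', (B t ∩ B t').encard) s (par s)
        (le_iSup_of_le (hpar s hs) le_rfl)) hk
    have h2 : (adh B s).encard ≤ k := (Set.encard_le_encard fun x hx => adh_subset hB hx).trans h1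
    exact_mod_cast (Set.ncard_le_encard _).trans h2

/-- Constructable graphs have control functions with at least two colours that are dilations
depending only on the adhesion and on the class of the torsos. -/
theorem exists_dilation_of_isConstructable (k : ℕ) {𝓗 : Set WeightedGraph.{u}} {n N : ℕ}
    (hnN : n ≤ N) (hN : 1 ≤ N) {f : Set.Ioi (0 : ℝ) → Set.Ioi (0 : ℝ)} (hf : IsDilation f)
    (h : ∀ H ∈ 𝓗, IsControlFunction n f H) :
    ∃ f' : Set.Ioi (0 : ℝ) → Set.Ioi (0 : ℝ), IsDilation f' ∧
      ∀ G, IsConstructable k 𝓗 G → IsControlFunction N f' G := by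
  obtain ⟨C, hC, hf⟩ := hf
  have hab : (0 : Fin (N + 1)) ≠ Fin.last N := fun e => by
    have := congrArg Fin.val e
    simp at this
    omega
  obtain ⟨K, hK, hcol⟩ := exists_colourable.{u, 0} hab hC.le k
  -- `K + 1` because a control function must be positive while `K` may vanish.
  refine ⟨fun r => ⟨(K + 1) * r, mul_pos (lt_of_le_of_lt hK (lt_add_one K)) r.2⟩,
    ⟨K + 1, by linarith, fun r => le_rfl⟩, ?_⟩
  rintro G ⟨τ, _, T, B, hTB, hk, hmem⟩ r
  obtain ⟨root⟩ := hTB.isTree.connected.nonempty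
  obtain ⟨_, par, hT, hadj, hpar⟩ := exists_isRooted hTB.isTree root
  have hB := isRootedDecomposition_of_isTreeDecomposition hT hadj hTB
  obtain ⟨c, hc⟩ := hcol hT hB (ncard_adh_le hT hB hpar hk)
    (bagsColourable hTB hnN hf fun t => h _ (hmem t)) r r.2
  have hr : (0 : ℝ) < r := r.2
  refine ⟨c, isColouring_of_chain fun x y hxy => ?_⟩
  refine G.scaleRel.mono (show K * r ≤ (K + 1) * r by nlinarith) (hc x y
    (ReflTransGen.mono (fun x y hxy => ⟨hxy.1, G.reach_of_rel hTB.edge_mem ⟨hr.le, hxy.2⟩⟩) _ _ hxy))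

end WeightedGraph

theorem mainTheorem5 (k : ℕ) (𝓖 𝓗 : Set WeightedGraph.{u})
    (h𝓖 : WeightedGraph.IsGraphClass 𝓖) (h𝓗 : WeightedGraph.IsGraphClass 𝓗)
    (hconstr : ∀ G ∈ 𝓖, WeightedGraph.IsConstructable k 𝓗 G) :
    WeightedGraph.ANdim 𝓖 ≤ max (WeightedGraph.ANdim 𝓗) 1 := by
  rcases Set.eq_empty_or_nonempty {N : ℕ∞ | ∃ n : ℕ, N = n ∧
      ∃ f : Set.Ioi (0 : ℝ) → Set.Ioi (0 : ℝ), WeightedGraph.IsDilation f ∧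
        ∀ G ∈ 𝓗, WeightedGraph.IsControlFunction n f G} with he | hne
  · have : WeightedGraph.ANdim 𝓗 = ⊤ := by rw [WeightedGraph.ANdim, he, sInf_empty]
    simp [this]
  · obtain ⟨n, hn, f, hf, h⟩ := csInf_mem hne
    obtain ⟨f', hf', h'⟩ := WeightedGraph.exists_dilation_of_isConstructable k
      (le_max_left n 1) (le_max_right n 1) hf h
    have hmax : max (WeightedGraph.ANdim 𝓗) 1 = ((max n 1 : ℕ) : ℕ∞) := by
      rw [WeightedGraph.ANdim, hn, (Nat.mono_cast (α := ℕ∞)).map_max, Nat.cast_one]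
    rw [hmax]
    exact sInf_le ⟨max n 1, rfl, f', hf', fun G hG => h' G (hconstr G hG)⟩
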